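/- **Setting.** Let $\mathcal H$ be a complex Hilbert space, $\mathcal A_0\subset B(\mathcal H)$ a unital $*$-algebra (the local observables) with norm closure $\mathcal A$ (the quasi-local algebra), and $\Omega\in\mathcal H$ a unit vector that is cyclic for $\mathcal A_0$. Let $U$ (space translations, of $\mathbb R^n$) and $V$ (time evolution, of $\mathbb R$) be commuting strongly continuous unitary groups fixing $\Omega$, with $U(x)\mathcal A_0U(x)^{-1}\subset\mathcal A_0$ and $V(t)\mathcal A V(t)^{-1}\subset\mathcal A$. Assume that $\omega(B)=(\Omega,B\Omega)$ is a KMS state on $\mathcal A$ for the time evolution at an inverse temperature $\beta>0$. An *observable* is a self-adjoint operator $X$, bounded or unbounded, that is affiliated with the von Neumann algebra $\mathcal A_0''$ and has $\Omega$ in its domain. Put $X(x)=U(x)XU(x)^{-1}$, $X(t)=V(t)XV(t)^{-1}$. Expectations of products are understood as quadratic forms: $(\Omega,XY\Omega):=(X\Omega,Y\Omega)$ for symmetric $X,Y$ defined on $\Omega$; so $(\Omega,[X,Y]\Omega)=(X\Omega,Y\Omega)-(Y\Omega,X\Omega)$, and $\langle XX\rangle^T=\|X\Omega\|^2-(\Omega,X\Omega)^2$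 is the truncated auto-correlation. Let $f\ge0$ be smooth with $f(s)=1$ for $0\le s\le1$ and $f(s)=0$ for $s\ge2$. For observables $q$ (the generator density of the symmetry) and $A$ put $$Q_R=\int q(x)\,f(|x|/R)\,d^nx,\qquad A_R=\int_{|x|\le R}A(x)\,d^nx .$$ Assume that the symmetry is spontaneously broken with symmetry breaking observable $A$: there is a number $c\neq0$ with $$\lim_{R\to\infty}(\Omega,[Q_R,A(t)]\,\Omega)=c\qquad\text{for all times }t\in\mathbb R .$$ **Conclusion (Canonical Pair).** 1. There is no $\alpha\in\mathbb R$ for which the auto-correlations $\langle R^{-\alpha}Q_R\,R^{-\alpha}Q_R\rangle^T$ and $\langle R^{-(n-\alpha)}A_R\,R^{-(n-\alpha)}A_R\rangle^T$ both remain bounded as $R\to\infty$. In particular, no such $\alpha$ gives finite auto-correlations together with a non-zero limit of $(\Omega,[R^{-\alpha}Q_R,R^{-(n-\alpha)}A_R]\Omega)$. 2. The limit fluctuations of the pair are classical (commuting): let $a,b\in\mathbb R$ be any exponents for which the auto-correlations of $R^{-a}Q_R$ and of $R^{-b}A_R$ both remain bounded as $R\to\infty$. If $(\Omega,[R^{-a}Q_R,R^{-b}A_R]\Omega)$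 has a limit as $R\to\infty$, then this limit is $0$. If $x\mapsto(\Omega,[q(x),A]\Omega)$ is integrable over $\mathbb R^n$ (for instance of compact support, as for local $q$ and $A$), then the limit exists and is $0$. -/

import Mathlib

open Filter Topology MeasureTheory
open scoped InnerProductSpace ContDiff

noncomputable section

/-- A strongly continuous unitary representation of an additive topological group. -/
structure UnitaryRep (G : Type*) [AddGroup G] [TopologicalSpace G]
    (H : Type*) [NormedAddCommGroup H] [InnerProductSpace ℂ H] where
  toFun : G → (H ≃ₗᵢ[ℂ] H)
  map_add : ∀ (x y : G) (ψ : H), toFun (x + y) ψ = toFun x (toFun y ψ)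
  continuous_apply : ∀ ψ : H, Continuous fun x => toFun x ψ

/-- The bounded operator `u B u⁻¹`. -/
def conjBounded {H : Type*} [NormedAddCommGroup H] [InnerProductSpace ℂ H]
    (u : H ≃ₗᵢ[ℂ] H) (B : H →L[ℂ] H) : H →L[ℂ] H :=
  (u : H →L[ℂ] H) ∘L B ∘L (u.symm : H →L[ℂ] H)

/-- The (possibly unbounded, partially defined) operator `u X u⁻¹`, with domain `u D(X)`. -/
def conjOp {H : Type*} [NormedAddCommGroup H] [InnerProductSpace ℂ H]
    (u : H ≃ₗᵢ[ℂ] H) (X : H →ₗ.[ℂ] H) : H →ₗ.[ℂ] H where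
  domain := X.domain.comap (u.symm.toLinearEquiv : H →ₗ[ℂ] H)
  toFun :=
    { toFun := fun ψ => u (X ⟨u.symm (ψ : H), ψ.2⟩)
      map_add' := fun ψ φ => by
        rw [← u.map_add, ← X.map_add]
        congr 2
        exact Subtype.ext (u.symm.map_add _ _)
      map_smul' := fun c ψ => by
        rw [RingHom.id_apply, ← u.map_smul, ← X.map_smul]
        congr 2
        exact Subtype.ext (u.symm.map_smul _ _) }

/-- A quantum system over the space `ℝⁿ` in the representation (Hilbert space `H`, vector `Ω`)
given by an invariant state: the `*`-algebra `localAlg` of local observables, whose norm closure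
is the quasi-local algebra; a cyclic unit vector `Ω`; space translations and time evolution,
implemented by commuting strongly continuous unitary groups that fix `Ω`.  The translations leave
the local algebra invariant, the time evolution leaves the quasi-local algebra invariant. -/
structure QuasiLocalSystem (n : ℕ) (H : Type*) [NormedAddCommGroup H] [InnerProductSpace ℂ H]
    [CompleteSpace H] where
  localAlg : StarSubalgebra ℂ (H →L[ℂ] H)
  space : UnitaryRep (EuclideanSpace ℝ (Fin n)) H
  time : UnitaryRep ℝ H
  Ω : H
  norm_Ω : ‖Ω‖ = 1
  cyclic : Dense {ψ : H | ∃ B ∈ localAlg, B Ω = ψ}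
  space_Ω : ∀ x, space.toFun x Ω = Ω
  time_Ω : ∀ t, time.toFun t Ω = Ω
  space_time : ∀ x t ψ,
    space.toFun x (time.toFun t ψ) = time.toFun t (space.toFun x ψ)
  space_localAlg : ∀ x, ∀ B ∈ localAlg, conjBounded (space.toFun x) B ∈ localAlg
  time_quasiLocal : ∀ t, ∀ B ∈ localAlg.topologicalClosure,
    conjBounded (time.toFun t) B ∈ localAlg.topologicalClosure

namespace QuasiLocalSystem

variable {n : ℕ} {H : Type*} [NormedAddCommGroup H] [InnerProductSpace ℂ H] [CompleteSpace H]
variable (S : QuasiLocalSystem n H)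

/-- The KMS condition at inverse temperature `β` for the state `ω(B) = (Ω, B Ω)` on the
quasi-local algebra, with respect to the time evolution `α_t(C) = V(t) C V(t)⁻¹`: for all `B`, `C`
there is a bounded continuous function on the strip `0 ≤ Im z ≤ β`, analytic in its interior, with
boundary values `ω(B α_t(C))` at `t` and `ω(α_t(C) B)` at `t + iβ`. -/
def IsKMS (β : ℝ) : Prop :=
  ∀ B ∈ S.localAlg.topologicalClosure, ∀ C ∈ S.localAlg.topologicalClosure,
    ∃ F : ℂ → ℂ,
      ContinuousOn F {z | 0 ≤ z.im ∧ z.im ≤ β} ∧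
      DifferentiableOn ℂ F {z | 0 < z.im ∧ z.im < β} ∧
      (∃ M : ℝ, ∀ z : ℂ, 0 ≤ z.im → z.im ≤ β → ‖F z‖ ≤ M) ∧
      ∀ t : ℝ,
        F t = ⟪S.Ω, B (conjBounded (S.time.toFun t) C S.Ω)⟫_ℂ ∧
        F (t + β * Complex.I) = ⟪S.Ω, conjBounded (S.time.toFun t) C (B S.Ω)⟫_ℂ

/-- An observable: a self-adjoint operator, bounded or not, that is affiliated with the von Neumann
algebra generated by the local observables (it commutes with every bounded operator commuting with
all local observables) and has `Ω` in its domain.  Self-adjoint elements of the quasi-local algebra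
are examples. -/
structure Observable where
  op : H →ₗ.[ℂ] H
  selfAdjoint : IsSelfAdjoint op
  affiliated : ∀ B' : H →L[ℂ] H, (∀ B ∈ S.localAlg, B' * B = B * B') →
    ∀ ψ : op.domain, ∃ h : B' (ψ : H) ∈ op.domain, op ⟨B' ψ, h⟩ = B' (op ψ)
  vacuum_mem : S.Ω ∈ op.domain

/-- The translate `X(x) = U(x) X U(x)⁻¹`. -/
def translate (X : H →ₗ.[ℂ] H) (x : EuclideanSpace ℝ (Fin n)) : H →ₗ.[ℂ] H :=
  conjOp (S.space.toFun x) X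

/-- The time evolved operator `X(t) = V(t) X V(t)⁻¹`. -/
def evolve (X : H →ₗ.[ℂ] H) (t : ℝ) : H →ₗ.[ℂ] H :=
  conjOp (S.time.toFun t) X

/-- The domain of `∫ g(x) X(x) dⁿx`: the vectors `ψ` that lie in the domain of all `X(x)` and for
which `x ↦ g(x) X(x) ψ` is integrable. -/
def smearDomain (X : H →ₗ.[ℂ] H) (g : EuclideanSpace ℝ (Fin n) → ℝ) : Submodule ℂ H where
  carrier := {ψ | ∃ h : ∀ x, ψ ∈ (S.translate X x).domain,
    Integrable fun x => g x • S.translate X x ⟨ψ, h x⟩}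
  zero_mem' := by
    refine ⟨fun x => Submodule.zero_mem _, (integrable_zero _ _ _).congr ?_⟩
    refine Eventually.of_forall fun x => ?_
    have h0 : S.translate X x ⟨0, Submodule.zero_mem (S.translate X x).domain⟩ = 0 :=
      (S.translate X x).map_zero
    change 0 = g x • S.translate X x ⟨0, _⟩
    rw [h0, smul_zero]
  add_mem' := by
    rintro ψ φ ⟨h, hi⟩ ⟨k, ki⟩
    refine ⟨fun x => Submodule.add_mem _ (h x) (k x), (hi.add ki).congr ?_⟩
    refine Eventually.of_forall fun x => ?_
    have h0 := (S.translate X x).map_add ⟨ψ, h x⟩ ⟨φ, k x⟩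
    exact (smul_add (g x) _ _).symm.trans (congrArg (g x • ·) h0.symm)
  smul_mem' := by
    rintro c ψ ⟨h, hi⟩
    refine ⟨fun x => Submodule.smul_mem _ c (h x), (hi.smul c).congr ?_⟩
    refine Eventually.of_forall fun x => ?_
    have h0 := (S.translate X x).map_smul c ⟨ψ, h x⟩
    exact (smul_comm c (g x) _).trans (congrArg (g x • ·) h0.symm)

/-- The operator `∫ g(x) X(x) dⁿx`. -/
def smear (X : H →ₗ.[ℂ] H) (g : EuclideanSpace ℝ (Fin n) → ℝ) : H →ₗ.[ℂ] H where
  domain := S.smearDomain X g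
  toFun :=
    { toFun := fun ψ => ∫ x, g x • S.translate X x ⟨ψ, ψ.2.choose x⟩
      map_add' := fun ψ φ => by
        refine Eq.trans ?_ (integral_add ψ.2.choose_spec φ.2.choose_spec)
        refine integral_congr_ae (Eventually.of_forall fun x => ?_)
        have h0 := (S.translate X x).map_add ⟨ψ, ψ.2.choose x⟩ ⟨φ, φ.2.choose x⟩
        exact (congrArg (g x • ·) h0).trans (smul_add (g x) _ _)
      map_smul' := fun c ψ => by
        refine Eq.trans ?_ (integral_smul c _)
        refine integral_congr_ae (Eventually.of_forall fun x => ?_)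
        have h0 := (S.translate X x).map_smul c ⟨ψ, ψ.2.choose x⟩
        exact (congrArg (g x • ·) h0).trans (smul_comm c (g x) _).symm }

open scoped Classical in
/-- The vector `X Ω`.  The value `0` for `Ω` outside the domain of `X` is a convention that plays no
role below: see `smear_vacuum`. -/
def vec (X : H →ₗ.[ℂ] H) : H :=
  if h : S.Ω ∈ X.domain then X ⟨S.Ω, h⟩ else 0

/-- The expectation `(Ω, X Ω)`. -/
def mean (X : H →ₗ.[ℂ] H) : ℂ := ⟪S.Ω, S.vec X⟫_ℂ

/-- The expectation `(Ω, [X, Y] Ω)` of the commutator of two symmetric operators, in the sense of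
quadratic forms: `(X Ω, Y Ω) - (Y Ω, X Ω)`. -/
def commutator (X Y : H →ₗ.[ℂ] H) : ℂ :=
  ⟪S.vec X, S.vec Y⟫_ℂ - ⟪S.vec Y, S.vec X⟫_ℂ

/-- The truncated auto-correlation `(Ω, X X Ω) - (Ω, X Ω)²` of a symmetric operator. -/
def autocorrelation (X : H →ₗ.[ℂ] H) : ℝ :=
  ‖S.vec X‖ ^ 2 - ‖S.mean X‖ ^ 2

/-- For an observable `X` and an integrable `g`, the vector `Ω` lies in the domain of
`∫ g(x) X(x) dⁿx`, which maps it to `∫ g(x) U(x) X Ω dⁿx`. -/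
theorem smear_vacuum (X : S.Observable) (g : EuclideanSpace ℝ (Fin n) → ℝ) (hg : Integrable g) :
    S.Ω ∈ (S.smear X.op g).domain ∧
      S.vec (S.smear X.op g) =
        ∫ x, g x • S.space.toFun x (X.op ⟨S.Ω, X.vacuum_mem⟩) := by
  have hfix : ∀ x, (S.space.toFun x).symm S.Ω = S.Ω := fun x => by
    rw [LinearIsometryEquiv.symm_apply_eq, S.space_Ω x]
  have hmem : ∀ x, S.Ω ∈ (S.translate X.op x).domain := fun x => by
    change (S.space.toFun x).symm S.Ω ∈ X.op.domain
    rw [hfix x]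
    exact X.vacuum_mem
  have hval : ∀ x, S.translate X.op x ⟨S.Ω, hmem x⟩ =
      S.space.toFun x (X.op ⟨S.Ω, X.vacuum_mem⟩) := fun x => by
    change S.space.toFun x (X.op ⟨(S.space.toFun x).symm S.Ω, _⟩) = _
    congr 2
    exact Subtype.ext (hfix x)
  have hint : Integrable fun x => g x • S.translate X.op x ⟨S.Ω, hmem x⟩ := by
    simp only [hval]
    exact hg.smul_bdd ‖X.op ⟨S.Ω, X.vacuum_mem⟩‖
      (S.space.continuous_apply _).aestronglyMeasurable
      (Eventually.of_forall fun x => by rw [LinearIsometryEquiv.norm_map])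
  have hdom : S.Ω ∈ (S.smear X.op g).domain := ⟨hmem, hint⟩
  refine ⟨hdom, ?_⟩
  rw [vec, dif_pos hdom]
  change (∫ x, g x • S.translate X.op x ⟨S.Ω, _⟩) = _
  exact integral_congr_ae (Eventually.of_forall fun x => congrArg (g x • ·) (hval x))

/-- `f` is the profile of an admissible smooth volume cut-off. -/
structure IsCutoff (f : ℝ → ℝ) : Prop where
  smooth : ContDiff ℝ ∞ f
  nonneg : ∀ s, 0 ≤ f s
  eq_one : ∀ s, 0 ≤ s → s ≤ 1 → f s = 1
  eq_zero : ∀ s, 2 ≤ s → f s = 0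

/-- The local charge `Q_R = ∫ q(x) f(|x| / R) dⁿx`. -/
def chargeR (f : ℝ → ℝ) (q : S.Observable) (R : ℝ) : H →ₗ.[ℂ] H :=
  S.smear q.op fun x => f (‖x‖ / R)

/-- The integral `A_R = ∫_{|x| ≤ R} A(x) dⁿx`. -/
def ballR (A : S.Observable) (R : ℝ) : H →ₗ.[ℂ] H :=
  S.smear A.op ((Metric.closedBall 0 R).indicator fun _ => 1)

/-- Spontaneous breaking of the symmetry with generator density `q`, with symmetry breaking
observable `A`: the limit of `(Ω, [Q_R, A(t)] Ω)` exists, is different from zero, and does not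
depend on the time `t`. -/
def SSB (f : ℝ → ℝ) (q A : S.Observable) : Prop :=
  ∃ c : ℂ, c ≠ 0 ∧ ∀ t : ℝ,
    Tendsto (fun R : ℝ => S.commutator (S.chargeR f q R) (S.evolve A.op t)) atTop (𝓝 c)

/-- The auto-correlation of the scaled operators `R^{-γ} X_R` remains finite as `R → ∞`. -/
def FiniteAutocorrelation (X : ℝ → (H →ₗ.[ℂ] H)) (γ : ℝ) : Prop :=
  ∃ C : ℝ, ∀ᶠ R : ℝ in atTop, S.autocorrelation (R ^ (-γ) • X R) ≤ C

end QuasiLocalSystem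

end

/-! Broken symmetry forces `a + b > n` whenever the auto-correlations of `R^{-a} Q_R` and `R^{-b}
A_R` stay bounded (`lt_add_of_finiteAutocorrelation`); both conclusions follow from this inequality.

The KMS condition enters through one estimate. Cauchy's theorem on the rectangle `[0,T] × [0,β]`
shows that the integral over `0 ≤ t ≤ T` of `(Ω, [X, Y(t)] Ω)` is at most `2β ‖XΩ‖ ‖YΩ‖`, uniformly
in `T`. Only vector norms occur, so the estimate passes to the closed real space spanned by the `BΩ`
with `B` self-adjoint and local (`norm_integral_commForm_le`). That space contains `XΩ` for every
observable `X` (`observable_mem_realSpace`, by resolvents and the bicommutant argument), and the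
norms may be truncated.

By translation invariance, `(Ω, [Q_R, A_R(t)] Ω)` is `R^n` times an integral of `(Ω, [q(x), A(t)]
Ω)` against `h(|x|/R)`, where `h` is the profile `f` convolved with the unit ball. If `a + b ≤ n`,
these `h`-means and their time integrals are bounded, while the `f`-means tend to `c` at every time.
Convergence of the `f`-means does not give convergence of the `h`-means, but it does give it for
their logarithmic averages in `R`, because multiplicative convolution of profiles is commutative
(`integral_radialMean_comm`, `tendsto_log_mean`). Hence `T h(0) |c|` is bounded in `T`, and `c = 0`
(`radial_limit_eq_zero`).

So `δ = a + b - n > 0`, and the scaled commutator is `R^{-δ}` times an `h`-mean. A limit `d ≠ 0`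
would make the `h`-means grow like `R^δ`, against the convergence of their logarithmic averages
(`radial_growth_eq_zero`). For an integrable commutator function the `h`-means are simply bounded.
-/

noncomputable section

/-! ### Resolvents of unbounded self-adjoint operators. -/

namespace LinearPMap

variable {H : Type*} [NormedAddCommGroup H] [InnerProductSpace ℂ H]

/-- The map `(x, y) ↦ x + i s y` on the graph of `T`. -/
def graphResolvent (T : H →ₗ.[ℂ] H) (s : ℝ) : T.graph →L[ℂ] H :=
  (ContinuousLinearMap.fst ℂ H H + ((s : ℂ) * Complex.I) • ContinuousLinearMap.snd ℂ H H) ∘L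
    T.graph.subtypeL

theorem graphResolvent_apply (T : H →ₗ.[ℂ] H) (s : ℝ) (p : T.graph) :
    T.graphResolvent s p = (p : H × H).1 + ((s : ℂ) * Complex.I) • (p : H × H).2 := rfl

variable [CompleteSpace H]

theorem isFormalAdjoint_self {T : H →ₗ.[ℂ] H} (hT : IsSelfAdjoint T) : T.IsFormalAdjoint T := by
  have h := adjoint_isFormalAdjoint hT.dense_domain
  rwa [isSelfAdjoint_def.mp hT] at h

theorem exists_mem_domain_of_inner_eq {T : H →ₗ.[ℂ] H} (hT : IsSelfAdjoint T) {y w : H}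
    (h : ∀ x : T.domain, ⟪w, (x : H)⟫_ℂ = ⟪y, T x⟫_ℂ) :
    ∃ hy : y ∈ T.domain, T ⟨y, hy⟩ = w := by
  have key : ∃ hy : y ∈ (T.adjoint).domain, T.adjoint ⟨y, hy⟩ = w :=
    ⟨mem_adjoint_domain_of_exists y ⟨w, h⟩, adjoint_apply_eq hT.dense_domain _ h⟩
  rwa [isSelfAdjoint_def.mp hT] at key

/-- The cross term is the real part of `i s (x, Tx)`, which vanishes because symmetry makes `(x,
Tx)` real. -/
theorem norm_add_I_smul_sq {T : H →ₗ.[ℂ] H} (hT : IsSelfAdjoint T) (s : ℝ) (x : T.domain) :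
    ‖(x : H) + (s * Complex.I) • T x‖ ^ 2 = ‖(x : H)‖ ^ 2 + s ^ 2 * ‖T x‖ ^ 2 := by
  have him : (⟪(x : H), T x⟫_ℂ).im = 0 := by
    have h1 := isFormalAdjoint_self hT x x
    have h2 := congrArg Complex.im h1
    rw [← inner_conj_symm, Complex.conj_im] at h2
    linarith
  rw [@norm_add_sq ℂ, inner_smul_right, norm_smul, mul_pow]
  simp [him]

theorem norm_graphResolvent_sq {T : H →ₗ.[ℂ] H} (hT : IsSelfAdjoint T) (s : ℝ) (p : T.graph) :
    ‖T.graphResolvent s p‖ ^ 2 = ‖(p : H × H).1‖ ^ 2 + s ^ 2 * ‖(p : H × H).2‖ ^ 2 := by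
  obtain ⟨x, hx⟩ := (mem_graph_iff T).1 p.2
  rw [graphResolvent_apply, ← hx.1, ← hx.2, norm_add_I_smul_sq hT]

theorem norm_fst_le_graphResolvent {T : H →ₗ.[ℂ] H} (hT : IsSelfAdjoint T) (s : ℝ) (p : T.graph) :
    ‖(p : H × H).1‖ ≤ ‖T.graphResolvent s p‖ := by
  refine (sq_le_sq₀ (norm_nonneg _) (norm_nonneg _)).1 ?_
  rw [norm_graphResolvent_sq hT]
  have : 0 ≤ s ^ 2 * ‖(p : H × H).2‖ ^ 2 := by positivity
  linarith

theorem norm_snd_le_graphResolvent {T : H →ₗ.[ℂ] H} (hT : IsSelfAdjoint T) (s : ℝ) (p : T.graph) :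
    |s| * ‖(p : H × H).2‖ ≤ ‖T.graphResolvent s p‖ := by
  refine (sq_le_sq₀ (by positivity) (norm_nonneg _)).1 ?_
  rw [norm_graphResolvent_sq hT, mul_pow, sq_abs]
  have : 0 ≤ ‖(p : H × H).1‖ ^ 2 := by positivity
  linarith

theorem exists_antilipschitz_graphResolvent {T : H →ₗ.[ℂ] H} (hT : IsSelfAdjoint T) {s : ℝ}
    (hs : s ≠ 0) : ∃ K, AntilipschitzWith K (T.graphResolvent s) := by
  refine ⟨Real.toNNReal (max 1 |s|⁻¹), (T.graphResolvent s).antilipschitz_of_bound fun p => ?_⟩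
  rw [Real.coe_toNNReal _ (le_max_of_le_left zero_le_one)]
  change max ‖(p : H × H).1‖ ‖(p : H × H).2‖ ≤ _
  have hs' : 0 < |s| := abs_pos.2 hs
  refine max_le ?_ ?_
  · calc ‖(p : H × H).1‖ ≤ 1 * ‖T.graphResolvent s p‖ := by
          rw [one_mul]; exact norm_fst_le_graphResolvent hT s p
      _ ≤ _ := mul_le_mul_of_nonneg_right (le_max_left _ _) (norm_nonneg _)
  · calc ‖(p : H × H).2‖ ≤ |s|⁻¹ * ‖T.graphResolvent s p‖ := by
          rw [inv_mul_eq_div, le_div_iff₀ hs', mul_comm]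
          exact norm_snd_le_graphResolvent hT s p
      _ ≤ _ := mul_le_mul_of_nonneg_right (le_max_right _ _) (norm_nonneg _)

theorem completeSpace_graph {T : H →ₗ.[ℂ] H} (hT : IsSelfAdjoint T) : CompleteSpace T.graph :=
  _root_.IsClosed.completeSpace_coe (hs := hT.isClosed)

theorem graphResolvent_injective {T : H →ₗ.[ℂ] H} (hT : IsSelfAdjoint T) {s : ℝ} (hs : s ≠ 0) :
    Function.Injective (T.graphResolvent s) :=
  (exists_antilipschitz_graphResolvent hT hs).choose_spec.injective

/-- The range is closed, since the map is bounded below on the complete graph. A vector `y`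
orthogonal to it lies in the domain of `T* = T` and satisfies `y - i s T y = 0`; the norm identity
with `-s` then gives `y = 0`. -/
theorem graphResolvent_surjective {T : H →ₗ.[ℂ] H} (hT : IsSelfAdjoint T) {s : ℝ} (hs : s ≠ 0) :
    Function.Surjective (T.graphResolvent s) := by
  have := completeSpace_graph hT
  obtain ⟨K, hK⟩ := exists_antilipschitz_graphResolvent hT hs
  have hcl : _root_.IsClosed (Set.range (T.graphResolvent s)) :=
    hK.isClosed_range (T.graphResolvent s).uniformContinuous
  have hr : ((T.graphResolvent s).range : Set H) = Set.range (T.graphResolvent s) := rfl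
  have hcl' : _root_.IsClosed ((T.graphResolvent s).range : Set H) := hr ▸ hcl
  have : CompleteSpace (T.graphResolvent s).range := _root_.IsClosed.completeSpace_coe (hs := hcl')
  have htop : (T.graphResolvent s).range = ⊤ := by
    rw [← Submodule.orthogonal_eq_bot_iff, Submodule.eq_bot_iff]
    intro y hy
    have horth : ∀ x : T.domain, ⟪y, (x : H) + ((s : ℂ) * Complex.I) • T x⟫_ℂ = 0 := fun x =>
      Submodule.inner_left_of_mem_orthogonal (K := (T.graphResolvent s).range)
        ⟨⟨(x, T x), T.mem_graph x⟩, rfl⟩ hy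
    have hsI : (s : ℂ) * Complex.I ≠ 0 := mul_ne_zero (by exact_mod_cast hs) Complex.I_ne_zero
    obtain ⟨hyd, hyT⟩ := exists_mem_domain_of_inner_eq (y := y)
        (w := (-(starRingEnd ℂ (((s : ℂ) * Complex.I)⁻¹))) • y) hT fun x => by
      have h := horth x
      rw [inner_add_right, inner_smul_right] at h
      have hc : starRingEnd ℂ (-(starRingEnd ℂ (((s : ℂ) * Complex.I)⁻¹))) =
          -((s : ℂ) * Complex.I)⁻¹ := by rw [RingHom.map_neg, Complex.conj_conj]
      rw [inner_smul_left, hc, neg_mul, neg_eq_iff_eq_neg,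
        inv_mul_eq_iff_eq_mul₀ hsI]
      linear_combination h
    have h0 := norm_add_I_smul_sq hT (-s) ⟨y, hyd⟩
    have h1 : (y : H) + (((-s : ℝ) : ℂ) * Complex.I) • T ⟨y, hyd⟩ = 0 := by
      rw [hyT, smul_smul]
      have : (((-s : ℝ) : ℂ) * Complex.I) * (-(starRingEnd ℂ (((s : ℂ) * Complex.I)⁻¹))) = -1 := by
        simp only [map_inv₀, map_mul, Complex.conj_ofReal, Complex.conj_I]
        have : (s : ℂ) ≠ 0 := by exact_mod_cast hs
        field_simp
        push_cast
        ring
      rw [this]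
      simp
    simp only [h1, norm_zero] at h0
    have h2 : 0 ≤ (-s) ^ 2 * ‖T ⟨y, hyd⟩‖ ^ 2 := by positivity
    have h3 : ‖y‖ ^ 2 = 0 := by
      have := sq_nonneg ‖y‖
      norm_num at h0
      linarith [h0, sq_nonneg ‖y‖, (by simpa using h2 : 0 ≤ s ^ 2 * ‖T ⟨y, hyd⟩‖ ^ 2)]
    exact norm_eq_zero.1 (pow_eq_zero_iff two_ne_zero |>.1 h3)
  intro y
  have : y ∈ (T.graphResolvent s).range := htop ▸ Submodule.mem_top
  exact this

/-- The resolvents `J_s = (1 + i s T)⁻¹` of a self-adjoint operator. -/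
theorem exists_resolvent {T : H →ₗ.[ℂ] H} (hT : IsSelfAdjoint T) {s : ℝ} (hs : s ≠ 0) :
    ∃ J : H →L[ℂ] H, (∀ ψ, ‖J ψ‖ ≤ ‖ψ‖) ∧
      (∀ ψ, ∃ h : J ψ ∈ T.domain, J ψ + ((s : ℂ) * Complex.I) • T ⟨J ψ, h⟩ = ψ) ∧
      ∀ x : T.domain, J ((x : H) + ((s : ℂ) * Complex.I) • T x) = x := by
  have := completeSpace_graph hT
  let e := ContinuousLinearEquiv.ofBijective (T.graphResolvent s)
    (LinearMap.ker_eq_bot.2 (graphResolvent_injective hT hs))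
    (LinearMap.range_eq_top.2 (graphResolvent_surjective hT hs))
  have he : ∀ p, e p = T.graphResolvent s p := fun p => rfl
  refine ⟨ContinuousLinearMap.fst ℂ H H ∘L T.graph.subtypeL ∘L (e.symm : H →L[ℂ] T.graph),
    fun ψ => ?_, fun ψ => ?_, fun x => ?_⟩
  · have h := norm_fst_le_graphResolvent hT s (e.symm ψ)
    rwa [← he, e.apply_symm_apply] at h
  · obtain ⟨x, hx⟩ := (mem_graph_iff T).1 (e.symm ψ).2
    have h := he (e.symm ψ)
    rw [e.apply_symm_apply, graphResolvent_apply] at h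
    change ∃ h : ((e.symm ψ : T.graph) : H × H).1 ∈ T.domain, _
    refine ⟨hx.1 ▸ x.2, ?_⟩
    have hval : T ⟨((e.symm ψ : T.graph) : H × H).1, hx.1 ▸ x.2⟩ =
        ((e.symm ψ : T.graph) : H × H).2 := by
      refine Eq.trans (congrArg T ?_) hx.2
      exact Subtype.ext hx.1.symm
    exact (congrArg (fun z => ((e.symm ψ : T.graph) : H × H).1 + ((s : ℂ) * Complex.I) • z)
      hval).trans h.symm
  · have h : (x : H) + ((s : ℂ) * Complex.I) • T x = e ⟨(x, T x), T.mem_graph x⟩ := rfl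
    rw [h]
    simp

end LinearPMap

/-! ### A two-vector form of the bicommutant theorem. -/

section Bicommutant

variable {H : Type*} [NormedAddCommGroup H] [InnerProductSpace ℂ H]

/-- The operator `B ⊕ B` on `H ⊕ H`. -/
def amplify (B : H →L[ℂ] H) : WithLp 2 (H × H) →L[ℂ] WithLp 2 (H × H) :=
  ((WithLp.prodContinuousLinearEquiv 2 ℂ H H).symm : H × H →L[ℂ] WithLp 2 (H × H)) ∘L
    (B.prodMap B) ∘L (WithLp.prodContinuousLinearEquiv 2 ℂ H H : WithLp 2 (H × H) →L[ℂ] H × H)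

/-- An operator on `H ⊕ H` commuting with all `B ⊕ B`, `B` in a set `M`, commutes with `J ⊕ J` for
every `J` in the bicommutant of `M`. -/
theorem amplify_comm_of_bicommutant {M : Set (H →L[ℂ] H)} {J : H →L[ℂ] H}
    (hJ : ∀ B' : H →L[ℂ] H, (∀ B ∈ M, B' * B = B * B') → B' * J = J * B')
    {P : WithLp 2 (H × H) →L[ℂ] WithLp 2 (H × H)}
    (hP : ∀ B ∈ M, ∀ x, P (amplify B x) = amplify B (P x)) (x : WithLp 2 (H × H)) :
    P (amplify J x) = amplify J (P x) := by
  let e := WithLp.prodContinuousLinearEquiv 2 ℂ H H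
  let inl : H →L[ℂ] WithLp 2 (H × H) := (e.symm : H × H →L[ℂ] _) ∘L ContinuousLinearMap.inl ℂ H H
  let inr : H →L[ℂ] WithLp 2 (H × H) := (e.symm : H × H →L[ℂ] _) ∘L ContinuousLinearMap.inr ℂ H H
  let fst : WithLp 2 (H × H) →L[ℂ] H :=
    ContinuousLinearMap.fst ℂ H H ∘L (e : WithLp 2 (H × H) →L[ℂ] _)
  let snd : WithLp 2 (H × H) →L[ℂ] H :=
    ContinuousLinearMap.snd ℂ H H ∘L (e : WithLp 2 (H × H) →L[ℂ] _)
  have hinl : ∀ (B : H →L[ℂ] H) a, inl (B a) = amplify B (inl a) := fun B a => by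
    change WithLp.toLp 2 (B a, (0 : H)) = WithLp.toLp 2 (B a, B 0)
    rw [map_zero]
  have hinr : ∀ (B : H →L[ℂ] H) a, inr (B a) = amplify B (inr a) := fun B a => by
    change WithLp.toLp 2 ((0 : H), B a) = WithLp.toLp 2 (B 0, B a)
    rw [map_zero]
  have hfst : ∀ (B : H →L[ℂ] H) y, fst (amplify B y) = B (fst y) := fun B y => rfl
  have hsnd : ∀ (B : H →L[ℂ] H) y, snd (amplify B y) = B (snd y) := fun B y => rfl
  -- Each of the four matrix entries `r P l` of `P` commutes with `M`, hence with `J`.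
  have comm : ∀ (l : H →L[ℂ] WithLp 2 (H × H)) (r : WithLp 2 (H × H) →L[ℂ] H),
      (∀ (B : H →L[ℂ] H) a, l (B a) = amplify B (l a)) →
      (∀ (B : H →L[ℂ] H) y, r (amplify B y) = B (r y)) →
      ∀ a, r (P (l (J a))) = J (r (P (l a))) := fun l r hl hr a => by
    have h := hJ (r ∘L P ∘L l) fun B hB => by
      ext b
      change r (P (l (B b))) = B (r (P (l b)))
      rw [hl, hP B hB, hr]
    exact DFunLike.congr_fun h a
  have hx : x = inl (fst x) + inr (snd x) := by
    refine e.injective ?_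
    change (fst x, snd x) = (fst x, (0 : H)) + ((0 : H), snd x)
    simp
  have hext : ∀ y z : WithLp 2 (H × H), fst y = fst z → snd y = snd z → y = z :=
    fun y z h1 h2 => e.injective (Prod.ext h1 h2)
  rw [hx]
  simp only [map_add, ← hinl, ← hinr]
  refine hext _ _ ?_ ?_
  · simp only [map_add, hfst, comm inl fst hinl hfst, comm inr fst hinr hfst]
  · simp only [map_add, hsnd, comm inl snd hinl hsnd, comm inr snd hinr hsnd]

variable [CompleteSpace H]

theorem inner_amplify_left (B : H →L[ℂ] H) (x y : WithLp 2 (H × H)) :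
    ⟪x, amplify B y⟫_ℂ = ⟪amplify (star B) x, y⟫_ℂ := by
  rw [WithLp.prod_inner_apply, WithLp.prod_inner_apply]
  exact congrArg₂ (· + ·) (ContinuousLinearMap.adjoint_inner_left B _ _).symm
    (ContinuousLinearMap.adjoint_inner_left B _ _).symm

/-- Invariance of `N` under the adjoint makes the orthogonal complement invariant under the operator
itself. -/
theorem starProjection_amplify_comm {N : Submodule ℂ (WithLp 2 (H × H))}
    [N.HasOrthogonalProjection] {B : H →L[ℂ] H} (h1 : ∀ x ∈ N, amplify B x ∈ N)
    (h2 : ∀ x ∈ N, amplify (star B) x ∈ N) (x : WithLp 2 (H × H)) :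
    N.starProjection (amplify B x) = amplify B (N.starProjection x) := by
  refine (Submodule.eq_starProjection_of_mem_of_inner_eq_zero
    (h1 _ (N.starProjection_apply_mem x)) fun w hw => ?_)
  rw [← map_sub, ← inner_conj_symm, inner_amplify_left, inner_conj_symm]
  exact Submodule.starProjection_inner_eq_zero _ _ (h2 w hw)

/-- A form of the bicommutant theorem: a functional `B ↦ (φ, B a) + (χ, B b)` which vanishes on a
unital `*`-algebra vanishes on its bicommutant. -/
theorem functional_eq_zero_of_bicommutant (M : StarSubalgebra ℂ (H →L[ℂ] H)) {J : H →L[ℂ] H}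
    (hJ : ∀ B' : H →L[ℂ] H, (∀ B ∈ M, B' * B = B * B') → B' * J = J * B') (φ χ a b : H)
    (h : ∀ B ∈ M, ⟪φ, B a⟫_ℂ + ⟪χ, B b⟫_ℂ = 0) : ⟪φ, J a⟫_ℂ + ⟪χ, J b⟫_ℂ = 0 := by
  let N₀ : Submodule ℂ (WithLp 2 (H × H)) :=
    { carrier := {x | ∃ B ∈ M, amplify B (WithLp.toLp 2 (a, b)) = x}
      zero_mem' := ⟨0, zero_mem M, rfl⟩
      add_mem' := by
        rintro _ _ ⟨B, hB, rfl⟩ ⟨C, hC, rfl⟩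
        exact ⟨B + C, add_mem hB hC, rfl⟩
      smul_mem' := by
        rintro c _ ⟨B, hB, rfl⟩
        exact ⟨c • B, M.smul_mem hB c, rfl⟩ }
  let N := N₀.topologicalClosure
  have hinv : ∀ B ∈ M, ∀ x ∈ N, amplify B x ∈ N := fun B hB x hx => by
    have hmaps : Set.MapsTo (amplify B) (N₀ : Set (WithLp 2 (H × H))) N₀ := by
      rintro _ ⟨C, hC, rfl⟩
      exact ⟨B * C, mul_mem hB hC, rfl⟩
    exact hmaps.closure (amplify B).continuous hx
  have hN : IsClosed (N : Set (WithLp 2 (H × H))) := N₀.isClosed_topologicalClosure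
  have : CompleteSpace N := IsClosed.completeSpace_coe (hs := hN)
  have hmem : WithLp.toLp 2 (a, b) ∈ N :=
    N₀.le_topologicalClosure ⟨1, one_mem M, rfl⟩
  -- `N` is the closed cyclic subspace of `(a, b)`, which contains `(a, b)` because `M` is unital.
  -- Its projection commutes with the amplified algebra, hence with `J ⊕ J`.
  have hJmem : amplify J (WithLp.toLp 2 (a, b)) ∈ N := by
    have h1 := amplify_comm_of_bicommutant (M := (M : Set (H →L[ℂ] H))) hJ
      (P := N.starProjection)
      (fun B hB x => starProjection_amplify_comm (hinv B hB) (hinv _ (star_mem hB)) x)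
      (WithLp.toLp 2 (a, b))
    rw [Submodule.starProjection_eq_self_iff.2 hmem] at h1
    exact Submodule.starProjection_eq_self_iff.1 h1
  have hclosed : IsClosed {x : WithLp 2 (H × H) | ⟪WithLp.toLp 2 (φ, χ), x⟫_ℂ = 0} :=
    isClosed_eq (by fun_prop) continuous_const
  have hsub : (N₀ : Set (WithLp 2 (H × H))) ⊆ {x | ⟪WithLp.toLp 2 (φ, χ), x⟫_ℂ = 0} := by
    rintro _ ⟨B, hB, rfl⟩
    exact h B hB
  exact closure_minimal hsub hclosed hJmem

end Bicommutant


/-! ### Elementary properties of unitary groups. -/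

namespace UnitaryRep

variable {G : Type*} [AddGroup G] [TopologicalSpace G]
  {H : Type*} [NormedAddCommGroup H] [InnerProductSpace ℂ H]

theorem zero_apply (U : UnitaryRep G H) (ψ : H) : U.toFun 0 ψ = ψ := by
  have h := U.map_add 0 0 ψ
  rw [add_zero] at h
  exact ((U.toFun 0).injective h).symm

theorem symm_apply (U : UnitaryRep G H) (x : G) (ψ : H) : (U.toFun x).symm ψ = U.toFun (-x) ψ := by
  rw [LinearIsometryEquiv.symm_apply_eq, ← U.map_add, add_neg_cancel, U.zero_apply]

theorem inner_left (U : UnitaryRep G H) (x : G) (ψ φ : H) :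
    ⟪U.toFun x ψ, φ⟫_ℂ = ⟪ψ, U.toFun (-x) φ⟫_ℂ := by
  rw [← U.symm_apply, ← LinearIsometryEquiv.inner_map_map (U.toFun x) ψ,
    LinearIsometryEquiv.apply_symm_apply]

theorem continuous_uncurry (U : UnitaryRep G H) :
    Continuous fun p : G × H => U.toFun p.1 p.2 := by
  refine continuous_iff_continuousAt.2 fun p₀ => ?_
  have h1 : Tendsto (fun p : G × H => U.toFun p.1 p₀.2) (𝓝 p₀) (𝓝 (U.toFun p₀.1 p₀.2)) :=
    ((U.continuous_apply p₀.2).comp continuous_fst).continuousAt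
  have h2 : Tendsto (fun p : G × H => U.toFun p.1 (p.2 - p₀.2)) (𝓝 p₀) (𝓝 0) := by
    rw [tendsto_zero_iff_norm_tendsto_zero]
    simp only [LinearIsometryEquiv.norm_map]
    have h : Continuous fun p : G × H => ‖p.2 - p₀.2‖ := by fun_prop
    simpa using h.tendsto p₀
  have h3 := h1.add h2
  rw [add_zero] at h3
  refine h3.congr fun p => ?_
  rw [← _root_.map_add]
  congr 1
  abel

end UnitaryRep

/-! ### The closed real subspace of self-adjoint local observables applied to `Ω`. -/

namespace QuasiLocalSystem

variable {n : ℕ} {H : Type*} [NormedAddCommGroup H] [InnerProductSpace ℂ H] [CompleteSpace H]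
variable (S : QuasiLocalSystem n H)

/-- The real subspace of the vectors `B Ω`, `B` a self-adjoint local observable. -/
def preRealSpace : Submodule ℝ H where
  carrier := {ψ | ∃ B ∈ S.localAlg, star B = B ∧ B S.Ω = ψ}
  zero_mem' := ⟨0, zero_mem _, star_zero _, rfl⟩
  add_mem' := by
    rintro _ _ ⟨B, hB, hB', rfl⟩ ⟨C, hC, hC', rfl⟩
    exact ⟨B + C, add_mem hB hC, by rw [star_add, hB', hC'], rfl⟩
  smul_mem' := by
    rintro c _ ⟨B, hB, hB', rfl⟩
    refine ⟨(c : ℂ) • B, S.localAlg.smul_mem hB _, ?_, ?_⟩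
    · rw [star_smul, hB', Complex.star_def, Complex.conj_ofReal]
    · change (c : ℂ) • B S.Ω = c • B S.Ω
      rw [Complex.coe_smul]

/-- The closed real subspace generated by the self-adjoint local observables. -/
def realSpace : Submodule ℝ H := S.preRealSpace.topologicalClosure

theorem isClosed_realSpace : IsClosed (S.realSpace : Set H) :=
  S.preRealSpace.isClosed_topologicalClosure

/-- A closed real subspace is its own double orthogonal complement for the real part of the inner
product. For self-adjoint `B` the expression in the hypothesis is `2 Re (φ, BΩ)`. It is complex
linear in `B`, so its vanishing extends to the whole algebra; this linear form is the one to which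
the bicommutant lemma applies. -/
theorem mem_realSpace_of_polar {v : H}
    (hv : ∀ φ : H, (∀ B ∈ S.localAlg, ⟪φ, B S.Ω⟫_ℂ + ⟪S.Ω, B φ⟫_ℂ = 0) → (⟪φ, v⟫_ℂ).re = 0) :
    v ∈ S.realSpace := by
  let : InnerProductSpace ℝ H := InnerProductSpace.rclikeToReal ℂ H
  have hre : ∀ x y : H, ⟪x, y⟫_ℝ = (⟪x, y⟫_ℂ).re := fun x y => rfl
  rw [realSpace, ← Submodule.orthogonal_orthogonal_eq_closure, Submodule.mem_orthogonal]
  intro φ hφ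
  rw [hre]
  refine hv φ ?_
  have hsa : ∀ B ∈ S.localAlg, star B = B → ⟪φ, B S.Ω⟫_ℂ + ⟪S.Ω, B φ⟫_ℂ = 0 := fun B hB hB' => by
    have h1 := (Submodule.mem_orthogonal' _ _).1 hφ (B S.Ω) ⟨B, hB, hB', rfl⟩
    rw [hre] at h1
    have h2 : ⟪S.Ω, B φ⟫_ℂ = starRingEnd ℂ ⟪φ, B S.Ω⟫_ℂ := by
      rw [inner_conj_symm]
      nth_rewrite 1 [← hB']
      exact ContinuousLinearMap.adjoint_inner_right B _ _
    rw [h2, Complex.add_conj, h1]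
    simp
  intro B hB
  have hB1 := hsa (B + star B) (add_mem hB (star_mem hB)) (by rw [star_add, star_star, add_comm])
  have hB2 := hsa (Complex.I • (B - star B)) (S.localAlg.smul_mem (sub_mem hB (star_mem hB)) _) (by
    rw [star_smul, star_sub, star_star, Complex.star_def, Complex.conj_I, neg_smul, ← smul_neg,
      neg_sub])
  simp only [add_apply, smul_apply, sub_apply, inner_add_right,
    inner_smul_right, inner_sub_right] at hB1 hB2
  linear_combination (1 / 2 : ℂ) * hB1 - (Complex.I / 2) * hB2 +
    (1 / 2 : ℂ) * (⟪φ, B S.Ω⟫_ℂ - ⟪φ, (star B) S.Ω⟫_ℂ + (⟪S.Ω, B φ⟫_ℂ - ⟪S.Ω, (star B) φ⟫_ℂ)) *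
      Complex.I_sq

theorem Ω_mem_realSpace : S.Ω ∈ S.realSpace :=
  S.preRealSpace.le_topologicalClosure ⟨1, one_mem _, star_one _, rfl⟩

theorem space_mem_realSpace (x : EuclideanSpace ℝ (Fin n)) {v : H} (hv : v ∈ S.realSpace) :
    S.space.toFun x v ∈ S.realSpace := by
  have hmaps : Set.MapsTo (S.space.toFun x) (S.preRealSpace : Set H) S.preRealSpace := by
    rintro _ ⟨B, hB, hB', rfl⟩
    refine ⟨_, S.space_localAlg x B hB, ?_, ?_⟩
    · rw [ContinuousLinearMap.star_eq_adjoint] at hB' ⊢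
      refine ((ContinuousLinearMap.eq_adjoint_iff _ _).2 fun a b => ?_).symm
      change ⟪S.space.toFun x (B ((S.space.toFun x).symm a)), b⟫_ℂ =
        ⟪a, S.space.toFun x (B ((S.space.toFun x).symm b))⟫_ℂ
      rw [S.space.symm_apply, S.space.symm_apply, S.space.inner_left]
      nth_rewrite 1 [← hB']
      rw [ContinuousLinearMap.adjoint_inner_left, S.space.inner_left, neg_neg]
    · change S.space.toFun x (B ((S.space.toFun x).symm S.Ω)) = _
      rw [S.space.symm_apply, S.space_Ω]
  exact hmaps.closure (S.space.toFun x).continuous hv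

theorem im_inner_Ω {v : H} (hv : v ∈ S.realSpace) : (⟪S.Ω, v⟫_ℂ).im = 0 := by
  have hcl : IsClosed {v : H | (⟪S.Ω, v⟫_ℂ).im = 0} :=
    isClosed_eq (by fun_prop) continuous_const
  refine closure_minimal ?_ hcl hv
  rintro _ ⟨B, hB, hB', rfl⟩
  have h : ⟪S.Ω, B S.Ω⟫_ℂ = starRingEnd ℂ ⟪S.Ω, B S.Ω⟫_ℂ := by
    rw [inner_conj_symm]
    nth_rewrite 1 [← hB']
    exact ContinuousLinearMap.adjoint_inner_right B _ _
  have h2 := congrArg Complex.im h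
  rw [Complex.conj_im] at h2
  change (⟪S.Ω, B S.Ω⟫_ℂ).im = 0
  linarith

/-- The orthogonal projection onto a closed real subspace commutes with the integral; a
non-integrable function has integral `0`. -/
theorem integral_mem_realSpace {α : Type*} [MeasurableSpace α] {μ : Measure α} {F : α → H}
    (hF : ∀ a, F a ∈ S.realSpace) : ∫ a, F a ∂μ ∈ S.realSpace := by
  by_cases hi : Integrable F μ
  · let : InnerProductSpace ℝ H := InnerProductSpace.rclikeToReal ℂ H
    have : CompleteSpace S.realSpace := IsClosed.completeSpace_coe (hs := S.isClosed_realSpace)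
    rw [← Submodule.starProjection_eq_self_iff, ← ContinuousLinearMap.integral_comp_comm _ hi]
    exact integral_congr_ae
      (Eventually.of_forall fun a => Submodule.starProjection_eq_self_iff.2 (hF a))
  · rw [integral_undef hi]
    exact zero_mem _

end QuasiLocalSystem

/-! ### Strong convergence of resolvents, and unbounded observables applied to `Ω`. -/

namespace LinearPMap

variable {H : Type*} [NormedAddCommGroup H] [InnerProductSpace ℂ H] [CompleteSpace H]

/-- `(1 + i s T)⁻¹ → 1` strongly as `s → 0`. -/
theorem tendsto_resolvent {T : H →ₗ.[ℂ] H} (hT : IsSelfAdjoint T) {s : ℕ → ℝ}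
    (hs : Tendsto s atTop (𝓝 0)) {J : ℕ → H →L[ℂ] H} (hJ : ∀ k ψ, ‖J k ψ‖ ≤ ‖ψ‖)
    (hJT : ∀ k, ∀ x : T.domain, J k ((x : H) + ((s k : ℂ) * Complex.I) • T x) = x) (ψ : H) :
    Tendsto (fun k => J k ψ) atTop (𝓝 ψ) := by
  rw [Metric.tendsto_atTop]
  intro ε hε
  obtain ⟨x, hx, hxψ⟩ := Metric.mem_closure_iff.1 (hT.dense_domain ψ) (ε / 3) (by positivity)
  have h1 : Tendsto (fun k => |s k| * ‖T ⟨x, hx⟩‖) atTop (𝓝 0) := by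
    have h := (hs.abs).mul_const ‖T ⟨x, hx⟩‖
    simpa using h
  obtain ⟨N, hN⟩ := Metric.tendsto_atTop.1 h1 (ε / 3) (by positivity)
  refine ⟨N, fun k hk => ?_⟩
  have h2 := hN k hk
  rw [Real.dist_eq, sub_zero, abs_of_nonneg (by positivity)] at h2
  -- For `x` in the domain, `J x = x - J (i s T x)`; the vector `ψ` is replaced by such an `x` at
  -- the cost of two errors `‖ψ - x‖`.
  have h3 : J k ψ - ψ =
      J k (ψ - x) - J k (((s k : ℂ) * Complex.I) • T ⟨x, hx⟩) - (ψ - x) := by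
    have h := hJT k ⟨x, hx⟩
    rw [_root_.map_add] at h
    have h' : J k x = x - J k (((s k : ℂ) * Complex.I) • T ⟨x, hx⟩) := eq_sub_of_add_eq h
    rw [_root_.map_sub, h']
    abel
  rw [dist_eq_norm] at hxψ ⊢
  rw [h3]
  have h4 : ‖J k (((s k : ℂ) * Complex.I) • T ⟨x, hx⟩)‖ ≤ |s k| * ‖T ⟨x, hx⟩‖ := by
    refine (hJ k _).trans_eq ?_
    rw [norm_smul]
    simp
  calc _ ≤ ‖J k (ψ - x)‖ + ‖J k (((s k : ℂ) * Complex.I) • T ⟨x, hx⟩)‖ + ‖ψ - x‖ :=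
        (norm_sub_le _ _).trans (add_le_add_left (norm_sub_le _ _) _)
    _ ≤ ‖ψ - x‖ + |s k| * ‖T ⟨x, hx⟩‖ + ‖ψ - x‖ := by
        gcongr
        exact hJ k _
    _ < ε := by linarith

end LinearPMap

namespace QuasiLocalSystem

variable {n : ℕ} {H : Type*} [NormedAddCommGroup H] [InnerProductSpace ℂ H] [CompleteSpace H]
variable (S : QuasiLocalSystem n H)

/-- The vector `X Ω` of an observable lies in the closed real subspace generated by the self-adjoint
local observables. -/
theorem observable_mem_realSpace (X : S.Observable) :
    X.op ⟨S.Ω, X.vacuum_mem⟩ ∈ S.realSpace := by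
  refine S.mem_realSpace_of_polar fun φ hφ => ?_
  have hT := X.selfAdjoint
  set v := X.op ⟨S.Ω, X.vacuum_mem⟩ with hv
  -- Here `J = (1 + i s X)⁻¹` and `J' = (1 - i s X)⁻¹ = J*`. By affiliation `J` lies in the
  -- bicommutant, so the functional `B ↦ (φ, BΩ) + (Ω, Bφ)` vanishes at `1` and at `J`; the
  -- difference of the two identities is `i s` times the claim.
  have key : ∀ s : ℝ, s ≠ 0 → ∀ J J' : H →L[ℂ] H,
      (∀ ψ, ∃ h : J ψ ∈ X.op.domain, J ψ + ((s : ℂ) * Complex.I) • X.op ⟨J ψ, h⟩ = ψ) →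
      (∀ x : X.op.domain, J ((x : H) + ((s : ℂ) * Complex.I) • X.op x) = x) →
      (∀ ψ, ∃ h : J' ψ ∈ X.op.domain, J' ψ + (((-s : ℝ) : ℂ) * Complex.I) • X.op ⟨J' ψ, h⟩ = ψ) →
      (∀ x : X.op.domain, J' ((x : H) + (((-s : ℝ) : ℂ) * Complex.I) • X.op x) = x) →
      ⟪φ, J v⟫_ℂ + ⟪J' v, φ⟫_ℂ = 0 := by
    intro s hs J J' h1 h2 h3 h4
    have hcomm : ∀ B' : H →L[ℂ] H, (∀ B ∈ S.localAlg, B' * B = B * B') → B' * J = J * B' := by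
      intro B' hB'
      ext ψ
      obtain ⟨h, hψ⟩ := h1 ψ
      obtain ⟨h', hB⟩ := X.affiliated B' hB' ⟨J ψ, h⟩
      have h5 := h2 ⟨B' (J ψ), h'⟩
      rw [hB] at h5
      change B' (J ψ) = J (B' ψ)
      conv_rhs => rw [← hψ, map_add, map_smul]
      exact h5.symm
    have hadj : ∀ ψ χ : H, ⟪J' ψ, χ⟫_ℂ = ⟪ψ, J χ⟫_ℂ := by
      intro ψ χ
      obtain ⟨h, hψ⟩ := h1 χ
      obtain ⟨h', hψ'⟩ := h3 ψ
      have hsym := LinearPMap.isFormalAdjoint_self hT ⟨J' ψ, h'⟩ ⟨J χ, h⟩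
      nth_rewrite 1 [← hψ]
      nth_rewrite 2 [← hψ']
      rw [inner_add_left, inner_add_right, inner_smul_left, inner_smul_right, hsym]
      simp
    have e0 := hφ 1 (one_mem _)
    have e1 := functional_eq_zero_of_bicommutant S.localAlg hcomm φ S.Ω S.Ω φ hφ
    have hsI : (s : ℂ) * Complex.I ≠ 0 := mul_ne_zero (by exact_mod_cast hs) Complex.I_ne_zero
    have e2 : J S.Ω = S.Ω - ((s : ℂ) * Complex.I) • J v := by
      have h := h2 ⟨S.Ω, X.vacuum_mem⟩
      rw [map_add, map_smul] at h
      exact eq_sub_of_add_eq h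
    have e3 : J' S.Ω = S.Ω + ((s : ℂ) * Complex.I) • J' v := by
      have h := h4 ⟨S.Ω, X.vacuum_mem⟩
      rw [map_add, map_smul] at h
      rw [eq_sub_of_add_eq h]
      push_cast
      rw [neg_mul, neg_smul, sub_neg_eq_add]
    rw [← hadj S.Ω φ, e2, e3, inner_sub_right, inner_add_left, inner_smul_left, inner_smul_right] at e1
    have e0' : ⟪φ, S.Ω⟫_ℂ + ⟪S.Ω, φ⟫_ℂ = 0 := e0
    refine mul_left_cancel₀ hsI ?_
    simp only [map_mul, Complex.conj_ofReal, Complex.conj_I] at e1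
    linear_combination e0' - e1
  -- With `s = 1/(k+1) → 0` both resolvents tend strongly to `1`, and `key` becomes `2 Re (φ, v) =
  -- 0`.
  have hpos : ∀ k : ℕ, (1 / ((k : ℝ) + 1)) ≠ 0 := fun k => by positivity
  choose J hJn hJd hJ using fun k : ℕ => LinearPMap.exists_resolvent hT (hpos k)
  choose J' hJn' hJd' hJ' using fun k : ℕ => LinearPMap.exists_resolvent hT (neg_ne_zero.2 (hpos k))
  have hlim : Tendsto (fun k : ℕ => 1 / ((k : ℝ) + 1)) atTop (𝓝 0) :=
    tendsto_one_div_add_atTop_nhds_zero_nat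
  have l1 := LinearPMap.tendsto_resolvent hT hlim hJn hJ v
  have l2 := LinearPMap.tendsto_resolvent hT (by simpa using hlim.neg) hJn' hJ' v
  have l3 := (tendsto_const_nhds (x := φ)).inner (𝕜 := ℂ) l1 |>.add
    (l2.inner (𝕜 := ℂ) (tendsto_const_nhds (x := φ)))
  have l4 : ⟪φ, v⟫_ℂ + ⟪v, φ⟫_ℂ = 0 :=
    tendsto_nhds_unique l3 ((tendsto_const_nhds (x := (0 : ℂ))).congr fun k =>
      (key _ (hpos k) (J k) (J' k) (hJd k) (hJ k) (hJd' k) (hJ' k)).symm)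
  rw [← inner_conj_symm v φ, Complex.add_conj] at l4
  have l5 : 2 * (⟪φ, v⟫_ℂ).re = 0 := by exact_mod_cast l4
  linarith

end QuasiLocalSystem


/-! ### The KMS condition and time integrals of commutators. -/

/-- The mean over a real interval of the jump of a bounded analytic function between the two edges
of a strip. -/
theorem norm_integral_edge_sub_le {β K M : ℝ} (hβ : 0 < β) {F : ℂ → ℂ}
    (hc : ContinuousOn F {z | 0 ≤ z.im ∧ z.im ≤ β})
    (hd : DifferentiableOn ℂ F {z | 0 < z.im ∧ z.im < β})
    (hM : ∀ z : ℂ, 0 ≤ z.im → z.im ≤ β → ‖F z‖ ≤ M)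
    (h0 : ∀ t : ℝ, ‖F t‖ ≤ K) (h1 : ∀ t : ℝ, ‖F (t + β * Complex.I)‖ ≤ K) (T : ℝ) :
    ‖∫ t in (0 : ℝ)..T, (F t - F (t + β * Complex.I))‖ ≤ 2 * β * K := by
  -- Phragmén–Lindelöf replaces the qualitative bound `M` in the strip by the edge bound `K`, so
  -- that `M` drops out of the estimate.
  have hbound : ∀ z : ℂ, 0 ≤ z.im → z.im ≤ β → ‖F z‖ ≤ K := by
    intro z hz0 hzβ
    refine PhragmenLindelof.horizontal_strip (a := 0) (b := β) (f := F) ⟨hd, ?_⟩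
      ⟨0, by rw [sub_zero]; positivity, 0, ?_⟩ (fun w hw => ?_) (fun w hw => ?_) hz0 hzβ
    · rw [Complex.closure_preimage_im, closure_Ioo hβ.ne]
      exact hc
    · refine Asymptotics.IsBigO.of_bound M ?_
      refine Filter.Eventually.filter_mono inf_le_right ?_
      refine Filter.eventually_principal.2 fun w hw => ?_
      simpa using hM w hw.1.le hw.2.le
    · have : w = (w.re : ℂ) := Complex.ext rfl (by simpa using hw)
      rw [this]
      exact h0 _
    · have : w = (w.re : ℂ) + β * Complex.I := Complex.ext (by simp) (by simpa using hw)
      rw [this]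
      exact h1 _
  -- By Cauchy's theorem the jump between the horizontal edges equals the difference of the two
  -- vertical sides, each of length `β` and hence at most `K β`.
  have hrect := Complex.integral_boundary_rect_eq_zero_of_continuousOn_of_differentiableOn F 0
    (T + β * Complex.I)
    (hc.mono fun z hz => by
      have h := (Complex.mem_reProdIm.1 hz).2
      rw [Complex.zero_im, Set.uIcc_of_le (by simpa using hβ.le)] at h
      simpa using h)
    (hd.mono fun z hz => by
      have h := (Complex.mem_reProdIm.1 hz).2
      rw [Complex.zero_im, min_eq_left (by simpa using hβ.le),
        max_eq_right (by simpa using hβ.le)] at h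
      simpa using h)
  simp only [Complex.zero_re, Complex.zero_im, Complex.add_re, Complex.ofReal_re, Complex.mul_re,
    Complex.I_re, mul_zero, Complex.ofReal_im, Complex.I_im, mul_one, sub_self, add_zero,
    Complex.add_im, Complex.mul_im, zero_add, Complex.ofReal_zero, zero_mul] at hrect
  have hi0 : IntervalIntegrable (fun t : ℝ => F t) volume 0 T := by
    refine ContinuousOn.intervalIntegrable ?_
    refine hc.comp (by fun_prop) fun t _ => ?_
    simpa using hβ.le
  have hi1 : IntervalIntegrable (fun t : ℝ => F (t + β * Complex.I)) volume 0 T := by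
    refine ContinuousOn.intervalIntegrable ?_
    refine hc.comp (by fun_prop) fun t _ => ?_
    simpa using hβ.le
  rw [intervalIntegral.integral_sub hi0 hi1]
  have e : (∫ t in (0 : ℝ)..T, F t) - ∫ t in (0 : ℝ)..T, F (t + β * Complex.I) =
      Complex.I • (∫ y in (0 : ℝ)..β, F (y * Complex.I)) -
        Complex.I • ∫ y in (0 : ℝ)..β, F (T + y * Complex.I) := by
    linear_combination hrect
  rw [e]
  have hside : ∀ a : ℝ, ‖∫ y in (0 : ℝ)..β, F (a + y * Complex.I)‖ ≤ K * β := fun a => by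
    have h := intervalIntegral.norm_integral_le_of_norm_le_const (a := 0) (b := β) (C := K)
      (f := fun y : ℝ => F (a + y * Complex.I)) fun y hy => by
        rw [Set.uIoc_of_le hβ.le] at hy
        exact hbound _ (by simpa using hy.1.le) (by simpa using hy.2)
    rwa [sub_zero, abs_of_pos hβ] at h
  have hside0 := hside 0
  simp only [Complex.ofReal_zero, zero_add] at hside0
  refine (norm_sub_le _ _).trans ?_
  rw [norm_smul, norm_smul, Complex.norm_I, one_mul, one_mul]
  linarith [hside T]

namespace QuasiLocalSystem

variable {n : ℕ} {H : Type*} [NormedAddCommGroup H] [InnerProductSpace ℂ H]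

/-- The commutator form `(v, w) - (w, v)`. -/
def commForm (v w : H) : ℂ := ⟪v, w⟫_ℂ - ⟪w, v⟫_ℂ

theorem norm_commForm_le (v w : H) : ‖commForm v w‖ ≤ 2 * (‖v‖ * ‖w‖) := by
  refine (norm_sub_le _ _).trans ?_
  have h1 := norm_inner_le_norm (𝕜 := ℂ) v w
  have h2 := norm_inner_le_norm (𝕜 := ℂ) w v
  linarith [mul_comm ‖v‖ ‖w‖]

theorem continuous_commForm : Continuous fun p : H × H => commForm p.1 p.2 := by
  unfold commForm
  fun_prop

theorem commForm_swap (v w : H) : commForm v w = -commForm w v := by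
  unfold commForm; ring

variable [CompleteSpace H] (S : QuasiLocalSystem n H)

/-- Self-adjointness turns the KMS boundary values into `(BΩ, V(t)CΩ)` and `(V(t)CΩ, BΩ)`.
Cauchy–Schwarz bounds both by vector norms alone, which is what allows the passage to limits of such
vectors. -/
theorem norm_integral_commForm_le_of_selfAdjoint {β : ℝ} (hβ : 0 < β) (hKMS : S.IsKMS β)
    {B C : H →L[ℂ] H} (hB : B ∈ S.localAlg) (hB' : star B = B) (hC : C ∈ S.localAlg)
    (hC' : star C = C) (T : ℝ) :
    ‖∫ t in (0 : ℝ)..T, commForm (B S.Ω) (S.time.toFun t (C S.Ω))‖ ≤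
      2 * β * (‖B S.Ω‖ * ‖C S.Ω‖) := by
  obtain ⟨F, hFc, hFd, ⟨M, hM⟩, hF⟩ := hKMS B (S.localAlg.le_topologicalClosure hB) C
    (S.localAlg.le_topologicalClosure hC)
  have hBs : ∀ x y : H, ⟪x, B y⟫_ℂ = ⟪B x, y⟫_ℂ := fun x y => by
    nth_rewrite 1 [← hB']
    exact ContinuousLinearMap.adjoint_inner_right B _ _
  have hCs : ∀ x y : H, ⟪x, C y⟫_ℂ = ⟪C x, y⟫_ℂ := fun x y => by
    nth_rewrite 1 [← hC']
    exact ContinuousLinearMap.adjoint_inner_right C _ _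
  have e0 : ∀ t : ℝ, F t = ⟪B S.Ω, S.time.toFun t (C S.Ω)⟫_ℂ := fun t => by
    rw [(hF t).1, hBs]
    change ⟪B S.Ω, S.time.toFun t (C ((S.time.toFun t).symm S.Ω))⟫_ℂ = _
    rw [S.time.symm_apply, S.time_Ω]
  have e1 : ∀ t : ℝ, F (t + β * Complex.I) = ⟪S.time.toFun t (C S.Ω), B S.Ω⟫_ℂ := fun t => by
    rw [(hF t).2]
    change ⟪S.Ω, S.time.toFun t (C ((S.time.toFun t).symm (B S.Ω)))⟫_ℂ = _
    rw [← S.time_Ω t, S.time.inner_left t (C _), ← S.time.symm_apply t, ← hCs]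
    nth_rewrite 3 [← S.time_Ω t]
    rw [LinearIsometryEquiv.inner_map_map]
    simp only [S.time_Ω]
  have h := norm_integral_edge_sub_le hβ hFc hFd hM (K := ‖B S.Ω‖ * ‖C S.Ω‖)
    (fun t => by
      rw [e0]
      refine (norm_inner_le_norm _ _).trans ?_
      rw [LinearIsometryEquiv.norm_map])
    (fun t => by
      rw [e1]
      refine (norm_inner_le_norm _ _).trans ?_
      rw [LinearIsometryEquiv.norm_map, mul_comm]) T
  simpa only [e0, e1, commForm] using h

theorem continuous_commForm_time :
    Continuous fun p : (H × H) × ℝ => commForm p.1.1 (S.time.toFun p.2 p.1.2) := by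
  have h1 : Continuous fun p : (H × H) × ℝ => S.time.toFun p.2 p.1.2 :=
    S.time.continuous_uncurry.comp (continuous_snd.prodMk (continuous_snd.comp continuous_fst))
  exact continuous_commForm.comp ((continuous_fst.comp continuous_fst).prodMk h1)

/-- The consequence of the KMS condition used below: time averages of commutators in the state tend
to zero. -/
theorem norm_integral_commForm_le {β : ℝ} (hβ : 0 < β) (hKMS : S.IsKMS β) {v w : H}
    (hv : v ∈ S.realSpace) (hw : w ∈ S.realSpace) (T : ℝ) :
    ‖∫ t in (0 : ℝ)..T, commForm v (S.time.toFun t w)‖ ≤ 2 * β * (‖v‖ * ‖w‖) := by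
  have hcl : IsClosed {p : H × H | ‖∫ t in (0 : ℝ)..T, commForm p.1 (S.time.toFun t p.2)‖ ≤
      2 * β * (‖p.1‖ * ‖p.2‖)} := by
    refine isClosed_le (Continuous.norm ?_) (by fun_prop)
    exact intervalIntegral.continuous_parametric_intervalIntegral_of_continuous'
      S.continuous_commForm_time 0 T
  have hmem : (v, w) ∈ closure ((S.preRealSpace : Set H) ×ˢ (S.preRealSpace : Set H)) := by
    rw [closure_prod_eq]
    exact ⟨hv, hw⟩
  refine closure_minimal ?_ hcl hmem
  rintro ⟨_, _⟩ ⟨⟨B, hB, hB', rfl⟩, ⟨C, hC, hC', rfl⟩⟩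
  exact S.norm_integral_commForm_le_of_selfAdjoint hβ hKMS hB hB' hC hC' T

/-- The component of `v` orthogonal to `Ω`. -/
def truncate (v : H) : H := v - ⟪S.Ω, v⟫_ℂ • S.Ω

theorem inner_Ω_Ω : ⟪S.Ω, S.Ω⟫_ℂ = 1 := by
  rw [inner_self_eq_norm_sq_to_K, S.norm_Ω]
  simp

theorem norm_truncate_sq (v : H) : ‖S.truncate v‖ ^ 2 = ‖v‖ ^ 2 - ‖⟪S.Ω, v⟫_ℂ‖ ^ 2 := by
  have h1 : v = S.truncate v + ⟪S.Ω, v⟫_ℂ • S.Ω := by rw [truncate, sub_add_cancel]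
  have h2 : ⟪S.truncate v, ⟪S.Ω, v⟫_ℂ • S.Ω⟫_ℂ = 0 := by
    rw [inner_smul_right, truncate, inner_sub_left, inner_smul_left, S.inner_Ω_Ω, inner_conj_symm]
    ring
  have h3 := norm_add_sq_eq_norm_sq_add_norm_sq_of_inner_eq_zero _ _ h2
  rw [← h1, norm_smul, S.norm_Ω, mul_one] at h3
  nlinarith [h3]

theorem truncate_mem_realSpace {v : H} (hv : v ∈ S.realSpace) : S.truncate v ∈ S.realSpace := by
  have h : ⟪S.Ω, v⟫_ℂ • S.Ω = (⟪S.Ω, v⟫_ℂ).re • S.Ω := by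
    rw [← Complex.coe_smul]
    congr 1
    exact Complex.ext rfl (by simpa using S.im_inner_Ω hv)
  rw [truncate, h]
  exact sub_mem hv (Submodule.smul_mem _ _ S.Ω_mem_realSpace)

/-- Vectors of the real space have real expectation in `Ω`, so real multiples of `Ω` have vanishing
commutator form with them, and `Ω` is invariant in time. -/
theorem commForm_truncate {v w : H} (hv : v ∈ S.realSpace) (hw : w ∈ S.realSpace) (t : ℝ) :
    commForm (S.truncate v) (S.time.toFun t (S.truncate w)) = commForm v (S.time.toFun t w) := by
  have hconj : ∀ {u : H}, u ∈ S.realSpace → starRingEnd ℂ ⟪S.Ω, u⟫_ℂ = ⟪S.Ω, u⟫_ℂ := fun hu =>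
    Complex.conj_eq_iff_im.2 (S.im_inner_Ω hu)
  have hΩt : ⟪S.Ω, S.time.toFun t w⟫_ℂ = ⟪S.Ω, w⟫_ℂ := by
    nth_rewrite 1 [← S.time_Ω t]
    exact LinearIsometryEquiv.inner_map_map _ _ _
  have htΩ : ⟪S.time.toFun t w, S.Ω⟫_ℂ = ⟪S.Ω, w⟫_ℂ := by
    rw [← inner_conj_symm, hΩt, hconj hw]
  have hvΩ : ⟪v, S.Ω⟫_ℂ = ⟪S.Ω, v⟫_ℂ := by rw [← inner_conj_symm, hconj hv]
  simp only [commForm, truncate, map_sub, map_smul, S.time_Ω, inner_sub_left, inner_sub_right,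
    inner_smul_left, inner_smul_right, S.inner_Ω_Ω, hΩt, htΩ, hvΩ, hconj hv, hconj hw]
  ring

theorem norm_commForm_time_le {v w : H} (hv : v ∈ S.realSpace) (hw : w ∈ S.realSpace) (t : ℝ) :
    ‖commForm v (S.time.toFun t w)‖ ≤ 2 * (‖S.truncate v‖ * ‖S.truncate w‖) := by
  rw [← S.commForm_truncate hv hw]
  simpa using norm_commForm_le (S.truncate v) (S.time.toFun t (S.truncate w))

theorem norm_integral_commForm_le_truncate {β : ℝ} (hβ : 0 < β) (hKMS : S.IsKMS β) {v w : H}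
    (hv : v ∈ S.realSpace) (hw : w ∈ S.realSpace) (T : ℝ) :
    ‖∫ t in (0 : ℝ)..T, commForm v (S.time.toFun t w)‖ ≤
      2 * β * (‖S.truncate v‖ * ‖S.truncate w‖) := by
  simpa only [S.commForm_truncate hv hw] using
    S.norm_integral_commForm_le hβ hKMS (S.truncate_mem_realSpace hv)
      (S.truncate_mem_realSpace hw) T

end QuasiLocalSystem


/-! ### Radial means and multiplicative convolution of profiles. -/

/-- `p` is a continuous profile on the half-line `s ≥ 0`, bounded by `M` and vanishing for
`s ≥ L`. -/
structure IsRadialProfile (p : ℝ → ℝ) (L M : ℝ) : Prop where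
  continuous : Continuous p
  one_le : 1 ≤ L
  bound : ∀ s, 0 ≤ s → |p s| ≤ M
  eq_zero : ∀ s, L ≤ s → p s = 0

namespace IsRadialProfile

variable {p : ℝ → ℝ} {L M : ℝ}

theorem nonneg (hp : IsRadialProfile p L M) : 0 ≤ M := (abs_nonneg _).trans (hp.bound 0 le_rfl)

theorem abs_exp_le (hp : IsRadialProfile p L M) (u : ℝ) :
    |p (Real.exp u)| ≤ (Set.Iic (Real.log L)).indicator (fun _ => M) u := by
  have hL : 0 < L := zero_lt_one.trans_le hp.one_le
  by_cases hu : u ∈ Set.Iic (Real.log L)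
  · rw [Set.indicator_of_mem hu]
    exact hp.bound _ (Real.exp_pos u).le
  · rw [Set.indicator_of_notMem hu, hp.eq_zero, abs_zero]
    rw [Set.mem_Iic, not_le] at hu
    exact ((Real.log_lt_iff_lt_exp hL).1 hu).le

end IsRadialProfile

section RadialMean

variable {E : Type*} [NormedAddCommGroup E] {g : E → ℂ} {C : ℝ} {p q : ℝ → ℝ} {L M L' M' : ℝ}

theorem norm_radial_smul_le (hg : ∀ x, ‖g x‖ ≤ C) (hp : IsRadialProfile p L M)
    {r : ℝ} (hr : 0 < r) (x : E) :
    ‖p (‖x‖ / r) • g x‖ ≤ (Metric.closedBall (0 : E) (L * r)).indicator (fun _ => M * C) x := by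
  by_cases hx : x ∈ Metric.closedBall (0 : E) (L * r)
  · rw [Set.indicator_of_mem hx, norm_smul]
    exact mul_le_mul (hp.bound _ (by positivity)) (hg x) (norm_nonneg _) hp.nonneg
  · rw [Set.indicator_of_notMem hx, hp.eq_zero, zero_smul, norm_zero]
    rw [mem_closedBall_zero_iff, not_le] at hx
    rw [le_div_iff₀ hr]
    exact hx.le

theorem continuous_radial_prod (hgc : Continuous g) (hpc : Continuous p) (hqc : Continuous q)
    (l : ℝ) : Continuous (Function.uncurry fun (u : ℝ) (x : E) =>
      q (Real.exp u) • p (‖x‖ / Real.exp (l + u)) • g x) := by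
  have h1 : Continuous fun z : ℝ × E => p (‖z.2‖ / Real.exp (l + z.1)) :=
    hpc.comp (Continuous.div (by fun_prop) (by fun_prop) fun z => (Real.exp_pos _).ne')
  have h2 : Continuous fun z : ℝ × E => q (Real.exp z.1) := by fun_prop
  have h3 : Continuous fun z : ℝ × E => g z.2 := by fun_prop
  exact h2.smul (h1.smul h3)

variable [NormedSpace ℝ E] [MeasurableSpace E] (μ : Measure E)

theorem integral_norm_radial_prod_le (hq : IsRadialProfile q L' M') (l u : ℝ) {K : ℝ}
    (hKp : ∀ r, 0 < r → ∫ x, ‖p (‖x‖ / r) • g x‖ ∂μ ≤ K * r ^ Module.finrank ℝ E) :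
    ∫ x, ‖q (Real.exp u) • p (‖x‖ / Real.exp (l + u)) • g x‖ ∂μ ≤
      (Set.Iic (Real.log L')).indicator (fun u : ℝ =>
        M' * (K * Real.exp ((Module.finrank ℝ E : ℝ) * l)) *
          Real.exp ((Module.finrank ℝ E : ℝ) * u)) u := by
  have e : ∫ x, ‖q (Real.exp u) • p (‖x‖ / Real.exp (l + u)) • g x‖ ∂μ =
      |q (Real.exp u)| * ∫ x, ‖p (‖x‖ / Real.exp (l + u)) • g x‖ ∂μ := by
    rw [← integral_const_mul]
    exact integral_congr_ae (Eventually.of_forall fun x => norm_smul _ _)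
  rw [e]
  have h1 := hq.abs_exp_le u
  by_cases hu : u ∈ Set.Iic (Real.log L')
  · rw [Set.indicator_of_mem hu] at h1 ⊢
    refine (mul_le_mul h1 (hKp _ (Real.exp_pos _))
      (integral_nonneg fun _ => norm_nonneg _) hq.nonneg).trans_eq ?_
    rw [← Real.exp_nat_mul, mul_add, Real.exp_add]
    ring
  · rw [Set.indicator_of_notMem hu] at h1 ⊢
    rw [le_antisymm h1 (abs_nonneg _), zero_mul]

variable [FiniteDimensional ℝ E] [BorelSpace E] [μ.IsAddHaarMeasure]

/-- The integral `∫ p(|x| / r) g(x) dx`. -/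
def radialMean (g : E → ℂ) (p : ℝ → ℝ) (r : ℝ) : ℂ := ∫ x, p (‖x‖ / r) • g x ∂μ

theorem integrable_indicator_closedBall (r K : ℝ) :
    Integrable ((Metric.closedBall (0 : E) r).indicator fun _ => K) μ :=
  (integrable_indicator_iff measurableSet_closedBall).2
    (integrableOn_const measure_closedBall_lt_top.ne)

theorem integrable_radial_smul (hgc : Continuous g) (hg : ∀ x, ‖g x‖ ≤ C)
    (hp : IsRadialProfile p L M) {r : ℝ} (hr : 0 < r) :
    Integrable (fun x => p (‖x‖ / r) • g x) μ := by
  refine (integrable_indicator_closedBall μ (L * r) (M * C)).mono' ?_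
    (Eventually.of_forall (norm_radial_smul_le hg hp hr))
  have := hp.continuous
  exact Continuous.aestronglyMeasurable (by fun_prop)

theorem integral_norm_radial_smul_le (hgc : Continuous g) (hg : ∀ x, ‖g x‖ ≤ C)
    (hp : IsRadialProfile p L M) {r : ℝ} (hr : 0 < r) :
    ∫ x, ‖p (‖x‖ / r) • g x‖ ∂μ ≤
      M * C * (L ^ Module.finrank ℝ E * μ.real (Metric.ball 0 1)) * r ^ Module.finrank ℝ E := by
  have hL : 0 < L := zero_lt_one.trans_le hp.one_le
  refine (integral_mono (integrable_radial_smul μ hgc hg hp hr).norm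
    (integrable_indicator_closedBall μ (L * r) (M * C))
    (norm_radial_smul_le hg hp hr)).trans_eq ?_
  rw [integral_indicator measurableSet_closedBall, setIntegral_const, smul_eq_mul,
    Measure.real, Measure.addHaar_closedBall μ _ (by positivity), ENNReal.toReal_mul,
    ENNReal.toReal_ofReal (by positivity), mul_pow, Measure.real]
  ring

theorem norm_radialMean_le (hgc : Continuous g) (hg : ∀ x, ‖g x‖ ≤ C)
    (hp : IsRadialProfile p L M) {r : ℝ} (hr : 0 < r) :
    ‖radialMean μ g p r‖ ≤
      M * C * (L ^ Module.finrank ℝ E * μ.real (Metric.ball 0 1)) * r ^ Module.finrank ℝ E :=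
  (norm_integral_le_integral_norm _).trans (integral_norm_radial_smul_le μ hgc hg hp hr)

variable [Nontrivial E]

/-- As `u → -∞` the factor `q (exp u)` need not decay. Integrability there comes from the volume
factor `exp (d u)`, whose exponent `d` is the dimension and must be positive. -/
theorem integrable_radial_prod (hgc : Continuous g) (hg : ∀ x, ‖g x‖ ≤ C)
    (hp : IsRadialProfile p L M) (hq : IsRadialProfile q L' M') (l : ℝ) :
    Integrable (Function.uncurry fun (u : ℝ) (x : E) =>
      q (Real.exp u) • p (‖x‖ / Real.exp (l + u)) • g x) (volume.prod μ) := by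
  have hmeas := (continuous_radial_prod hgc hp.continuous hq.continuous
    l).aestronglyMeasurable (μ := (volume : Measure ℝ).prod μ)
  have hd : (0 : ℝ) < Module.finrank ℝ E := by exact_mod_cast Module.finrank_pos
  refine (integrable_prod_iff hmeas).2 ⟨Eventually.of_forall fun u => ?_, ?_⟩
  · have h1 := integrable_radial_smul μ hgc hg hp (Real.exp_pos (l + u))
    have h2 := Integrable.smul (q (Real.exp u)) h1
    exact h2
  have hKp := fun r hr => integral_norm_radial_smul_le μ hgc hg hp (r := r) hr
  generalize M * C * (L ^ Module.finrank ℝ E * μ.real (Metric.ball 0 1)) = K at hKp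
  have hint : Integrable ((Set.Iic (Real.log L')).indicator fun u : ℝ =>
      M' * (K * Real.exp ((Module.finrank ℝ E : ℝ) * l)) *
        Real.exp ((Module.finrank ℝ E : ℝ) * u)) :=
    (integrable_indicator_iff measurableSet_Iic).2
      ((integrableOn_exp_mul_Iic hd _).const_mul _)
  refine hint.mono' hmeas.norm.integral_prod_right' (Eventually.of_forall fun u => ?_)
  rw [Real.norm_of_nonneg (integral_nonneg fun _ => norm_nonneg _)]
  exact integral_norm_radial_prod_le μ hq l u hKp

/-- Multiplicative convolution of two radial profiles is commutative. -/
theorem integral_radialMean_comm (hgc : Continuous g) (hg : ∀ x, ‖g x‖ ≤ C)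
    (hp : IsRadialProfile p L M) (hq : IsRadialProfile q L' M') (l : ℝ) :
    ∫ u : ℝ, q (Real.exp u) • radialMean μ g p (Real.exp (l + u)) =
      ∫ u : ℝ, p (Real.exp u) • radialMean μ g q (Real.exp (l + u)) := by
  have swap : ∀ {p q : ℝ → ℝ} {L M L' M' : ℝ}, IsRadialProfile p L M → IsRadialProfile q L' M' →
      ∫ u : ℝ, q (Real.exp u) • radialMean μ g p (Real.exp (l + u)) =
        ∫ x, (∫ u : ℝ, q (Real.exp u) • p (‖x‖ / Real.exp (l + u)) • g x) ∂μ := by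
    intro p q L M L' M' hp hq
    rw [← integral_integral_swap (integrable_radial_prod μ hgc hg hp hq l)]
    refine integral_congr_ae (Eventually.of_forall fun u => ?_)
    exact (integral_smul _ _).symm
  rw [swap hp hq, swap hq hp]
  refine integral_congr_ae ?_
  have hne : ∀ᵐ x ∂μ, x ≠ 0 := by
    refine compl_mem_ae_iff.2 ?_
    exact measure_singleton 0
  filter_upwards [hne] with x hx
  have hx' : 0 < ‖x‖ := norm_pos_iff.2 hx
  -- The reflection `u ↦ log ‖x‖ - l - u` exchanges `exp u` with `‖x‖ / exp (l + u)`, and so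
  -- exchanges the roles of `p` and `q`.
  rw [← integral_sub_left_eq_self _ volume (Real.log ‖x‖ - l)]
  refine integral_congr_ae (Eventually.of_forall fun u => ?_)
  have e1 : Real.exp (Real.log ‖x‖ - l - u) = ‖x‖ / Real.exp (l + u) := by
    rw [sub_sub, Real.exp_sub, Real.exp_log hx']
  have e2 : ‖x‖ / Real.exp (l + (Real.log ‖x‖ - l - u)) = Real.exp u := by
    rw [show l + (Real.log ‖x‖ - l - u) = Real.log ‖x‖ - u by ring, Real.exp_sub,
      Real.exp_log hx', div_div_cancel₀ hx'.ne']
  simp only [e1, e2]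
  exact smul_comm _ _ _

end RadialMean

/-! ### Averages on the logarithmic scale. -/

section Scaling

theorem min_one_exp_mul_le {l : ℝ} (hl : 1 ≤ l) (s : ℝ) : min 1 (Real.exp (l * s)) ≤ Real.exp s := by
  rcases le_total 0 s with hs | hs
  · exact (min_le_left _ _).trans (Real.one_le_exp hs)
  · refine (min_le_right _ _).trans (Real.exp_le_exp.2 ?_)
    nlinarith

/-- Substituting `u = l (s - 1)` displays the convolution divided by `l` as an average over the
logarithmic scale `s`, with the radius `exp l` at `s = 1`. -/
theorem integral_scaled (G : ℝ → ℝ) (φ : ℝ → ℂ) {l : ℝ} (hl : 0 < l) :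
    ∫ s : ℝ, G (l * (s - 1)) • φ (l * s) = l⁻¹ • ∫ u : ℝ, G u • φ (l + u) := by
  have h := Measure.integral_comp_mul_left (fun u => G (u - l) • φ u) l
  rw [abs_of_pos (inv_pos.2 hl)] at h
  simp only [mul_sub, mul_one]
  rw [h, ← integral_add_left_eq_self _ l]
  simp

/-- A kernel on the line, bounded by `M` and vanishing on `(a, ∞)`. -/
structure IsLogKernel (G : ℝ → ℝ) (a M : ℝ) : Prop where
  measurable : Measurable G
  nonneg : 0 ≤ a
  le : ∀ u, |G u| ≤ (Set.Iic a).indicator (fun _ => M) u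

theorem IsRadialProfile.isLogKernel {p : ℝ → ℝ} {L M : ℝ} (hp : IsRadialProfile p L M) :
    IsLogKernel (fun u => p (Real.exp u)) (Real.log L) M :=
  ⟨(hp.continuous.comp Real.continuous_exp).measurable, Real.log_nonneg hp.one_le, hp.abs_exp_le⟩

variable {G : ℝ → ℝ} {a M C : ℝ}

theorem IsLogKernel.bound_nonneg (hG : IsLogKernel G a M) : 0 ≤ M := by
  have h := hG.le 0
  rw [Set.indicator_of_mem (show (0 : ℝ) ∈ Set.Iic a from hG.nonneg)] at h
  exact (abs_nonneg _).trans h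

theorem IsLogKernel.norm_scaled_le (hG : IsLogKernel G a M) {φ : ℝ → ℂ}
    (hφ : ∀ u, ‖φ u‖ ≤ C * min 1 (Real.exp u)) {l : ℝ} (hl : 1 ≤ l) (s : ℝ) :
    ‖G (l * (s - 1)) • φ (l * s)‖ ≤
      (Set.Iic (1 + a)).indicator (fun s => M * C * Real.exp s) s := by
  have hC : 0 ≤ C := by
    have h := (norm_nonneg _).trans (hφ 0)
    simpa using h
  have hM := hG.bound_nonneg
  rw [norm_smul]
  have h1 := hG.le (l * (s - 1))
  by_cases hs : s ∈ Set.Iic (1 + a)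
  · rw [Set.indicator_of_mem hs]
    have h2 : |G (l * (s - 1))| ≤ M := h1.trans (Set.indicator_le_self' (fun _ _ => hM) _)
    calc _ ≤ M * (C * min 1 (Real.exp (l * s))) :=
          mul_le_mul h2 (hφ _) (norm_nonneg _) hM
      _ ≤ M * (C * Real.exp s) := by
          have := min_one_exp_mul_le hl s
          gcongr
      _ = _ := by ring
  · rw [Set.indicator_of_notMem hs]
    have h3 : l * (s - 1) ∉ Set.Iic a := by
      rw [Set.mem_Iic, not_le] at hs ⊢
      have := hG.nonneg
      nlinarith
    rw [Set.indicator_of_notMem h3] at h1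
    rw [Real.norm_eq_abs, le_antisymm h1 (abs_nonneg _), zero_mul]

theorem integrable_indicator_exp (a K : ℝ) :
    Integrable ((Set.Iic a).indicator fun s => K * Real.exp s) :=
  (integrable_indicator_iff measurableSet_Iic).2 ((integrableOn_exp_Iic _).const_mul _)

theorem IsLogKernel.norm_integral_scaled_le (hG : IsLogKernel G a M) {φ : ℝ → ℂ}
    (hφ : ∀ u, ‖φ u‖ ≤ C * min 1 (Real.exp u)) {l : ℝ} (hl : 1 ≤ l) :
    ‖∫ s : ℝ, G (l * (s - 1)) • φ (l * s)‖ ≤ M * C * Real.exp (1 + a) := by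
  refine (norm_integral_le_of_norm_le (integrable_indicator_exp (1 + a) (M * C))
    (Eventually.of_forall (hG.norm_scaled_le hφ hl))).trans_eq ?_
  rw [integral_indicator measurableSet_Iic, integral_const_mul, integral_exp_Iic]

/-- The integrand tends to `0` for `s < 0`, where `φ (l s)` decays, to `h₀ c` for `0 < s < 1`, and
to `0` for `s > 1`, where the kernel eventually vanishes. The limit is therefore `h₀ c` times the
length of `(0, 1)`. -/
theorem IsLogKernel.tendsto_integral_scaled (hG : IsLogKernel G a M) {h₀ : ℝ}
    (hG0 : Tendsto G atBot (𝓝 h₀)) {φ : ℝ → ℂ} (hφm : Measurable φ)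
    (hφ : ∀ u, ‖φ u‖ ≤ C * min 1 (Real.exp u)) {c : ℂ} (hφc : Tendsto φ atTop (𝓝 c)) :
    Tendsto (fun l : ℝ => ∫ s : ℝ, G (l * (s - 1)) • φ (l * s)) atTop (𝓝 (h₀ • c)) := by
  have hGm := hG.measurable
  have hlim : h₀ • c = ∫ s : ℝ, (Set.Ioo (0 : ℝ) 1).indicator (fun _ => h₀ • c) s := by
    rw [integral_indicator measurableSet_Ioo, setIntegral_const]
    simp
  rw [hlim]
  refine tendsto_integral_filter_of_dominated_convergence
    ((Set.Iic (1 + a)).indicator fun s => M * C * Real.exp s) ?_ ?_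
    (integrable_indicator_exp (1 + a) (M * C)) ?_
  · refine Eventually.of_forall fun l => Measurable.aestronglyMeasurable ?_
    fun_prop
  · filter_upwards [eventually_ge_atTop 1] with l hl
    exact Eventually.of_forall (hG.norm_scaled_le hφ hl)
  · have hne : ∀ x : ℝ, ∀ᵐ s : ℝ, s ≠ x := fun x => compl_mem_ae_iff.2 (measure_singleton x)
    filter_upwards [hne 0, hne 1] with s hs0 hs1
    rcases lt_or_gt_of_ne hs0 with hs | hs
    · have hs' : s ∉ Set.Ioo (0 : ℝ) 1 := fun h => absurd h.1 hs.le.not_gt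
      rw [Set.indicator_of_notMem hs']
      have hφ0 : Tendsto φ atBot (𝓝 0) := by
        refine squeeze_zero_norm (a := fun u => C * Real.exp u) (fun u => ?_) ?_
        · have hC : 0 ≤ C := by simpa using (norm_nonneg _).trans (hφ 0)
          exact (hφ u).trans (mul_le_mul_of_nonneg_left (min_le_right _ _) hC)
        · simpa using Real.tendsto_exp_atBot.const_mul C
      have t1 : Tendsto (fun l : ℝ => l * (s - 1)) atTop atBot :=
        tendsto_id.atTop_mul_const_of_neg (by linarith)
      have t2 : Tendsto (fun l : ℝ => l * s) atTop atBot := tendsto_id.atTop_mul_const_of_neg hs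
      simpa using (hG0.comp t1).smul (hφ0.comp t2)
    · have t2 : Tendsto (fun l : ℝ => l * s) atTop atTop := tendsto_id.atTop_mul_const hs
      rcases lt_or_gt_of_ne hs1 with hs' | hs'
      · rw [Set.indicator_of_mem (show s ∈ Set.Ioo (0 : ℝ) 1 from ⟨hs, hs'⟩)]
        have t1 : Tendsto (fun l : ℝ => l * (s - 1)) atTop atBot :=
          tendsto_id.atTop_mul_const_of_neg (by linarith)
        exact (hG0.comp t1).smul (hφc.comp t2)
      · rw [Set.indicator_of_notMem (fun h => absurd h.2 hs'.le.not_gt)]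
        have t1 : Tendsto (fun l : ℝ => l * (s - 1)) atTop atTop :=
          tendsto_id.atTop_mul_const (by linarith)
        refine tendsto_const_nhds.congr' ?_
        filter_upwards [t1.eventually_gt_atTop a] with l hl
        have h1 := hG.le (l * (s - 1))
        rw [Set.indicator_of_notMem (by rwa [Set.mem_Iic, not_le])] at h1
        rw [abs_eq_zero.1 (le_antisymm h1 (abs_nonneg _)), zero_smul]

/-- The volume bound controls `u ≤ u₀` and the uniform bound controls `u ≥ u₀`. Since `d ≥ 1`, `exp
u ^ d ≤ exp u` for `u ≤ 0`, so one integrable majorant serves in every dimension. -/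
theorem norm_le_mul_min_one_exp {φ : ℝ → ℂ} {K u₀ : ℝ} {d : ℕ} (hd : 1 ≤ d) (hu₀ : 0 ≤ u₀)
    (hC : 0 ≤ C) (hK : 0 ≤ K)
    (h1 : ∀ u, ‖φ u‖ ≤ C * Real.exp u ^ d) (h2 : ∀ u, u₀ ≤ u → ‖φ u‖ ≤ K) (u : ℝ) :
    ‖φ u‖ ≤ (K + C * Real.exp u₀ ^ d) * min 1 (Real.exp u) := by
  have h3 : 1 ≤ Real.exp u₀ ^ d := one_le_pow₀ (Real.one_le_exp hu₀)
  rcases le_total 0 u with hu | hu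
  · rw [min_eq_left (Real.one_le_exp hu), mul_one]
    rcases le_total u₀ u with h | h
    · have := h2 u h
      nlinarith [mul_nonneg hC (zero_le_one.trans h3)]
    · have : Real.exp u ^ d ≤ Real.exp u₀ ^ d := by gcongr
      nlinarith [h1 u, mul_le_mul_of_nonneg_left this hC]
  · rw [min_eq_right (Real.exp_le_one_iff.2 hu)]
    have h4 : Real.exp u ^ d ≤ Real.exp u :=
      pow_le_of_le_one (Real.exp_pos u).le (Real.exp_le_one_iff.2 hu) (by omega)
    calc ‖φ u‖ ≤ C * Real.exp u ^ d := h1 u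
      _ ≤ C * Real.exp u := by gcongr
      _ ≤ (C * Real.exp u₀ ^ d) * Real.exp u := by
          have := Real.exp_pos u
          nlinarith [mul_nonneg hC this.le]
      _ ≤ _ := by
          have := Real.exp_pos u
          nlinarith

end Scaling


/-! ### Comparison of radial means with different profiles. -/

section RadialLimits

variable {E : Type*} [NormedAddCommGroup E] [NormedSpace ℝ E] [FiniteDimensional ℝ E]
  [MeasurableSpace E] [BorelSpace E] {μ : Measure E} [μ.IsAddHaarMeasure]
  {C : ℝ} {p q : ℝ → ℝ} {L M L' M' : ℝ}

theorem tendsto_profile_exp_atBot (hp : Continuous p) :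
    Tendsto (fun u => p (Real.exp u)) atBot (𝓝 (p 0)) :=
  (hp.tendsto 0).comp Real.tendsto_exp_atBot

theorem stronglyMeasurable_radialMean {α : Type*} [TopologicalSpace α] [MeasurableSpace α]
    [OpensMeasurableSpace α] [SecondCountableTopology α] {g : α → E → ℂ}
    (hg : Continuous (Function.uncurry g)) {p : ℝ → ℝ} (hp : Continuous p) :
    StronglyMeasurable fun z : α × ℝ => radialMean μ (g z.1) p (Real.exp z.2) := by
  refine StronglyMeasurable.integral_prod_right (f := fun (z : α × ℝ) (x : E) =>
    p (‖x‖ / Real.exp z.2) • g z.1 x) (Continuous.stronglyMeasurable ?_)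
  have h1 : Continuous fun z : (α × ℝ) × E => p (‖z.2‖ / Real.exp z.1.2) :=
    hp.comp (Continuous.div (by fun_prop) (by fun_prop) fun z => (Real.exp_pos _).ne')
  have h2 : Continuous fun z : (α × ℝ) × E => g z.1.1 z.2 :=
    hg.comp ((continuous_fst.comp continuous_fst).prodMk continuous_snd)
  exact h1.smul h2

theorem measurable_radialMean_exp {g : E → ℂ} (hg : Continuous g) (hp : Continuous p) :
    Measurable fun u => radialMean μ g p (Real.exp u) :=
  ((stronglyMeasurable_radialMean (μ := μ) (α := Unit) (g := fun _ => g)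
    (hg.comp continuous_snd) hp).comp_measurable
    (g := fun u : ℝ => ((), u)) (by fun_prop)).measurable

theorem exists_radialMean_exp_le {g : E → ℂ} (hgc : Continuous g) (hg : ∀ x, ‖g x‖ ≤ C)
    (hp : IsRadialProfile p L M) : ∃ K, 0 ≤ K ∧ ∀ u,
      ‖radialMean μ g p (Real.exp u)‖ ≤ K * Real.exp u ^ Module.finrank ℝ E := by
  refine ⟨M * C * (L ^ Module.finrank ℝ E * μ.real (Metric.ball 0 1)), ?_,
    fun u => norm_radialMean_le μ hgc hg hp (Real.exp_pos u)⟩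
  have h1 := hp.nonneg
  have h2 : 0 ≤ C := (norm_nonneg _).trans (hg 0)
  have h3 : 0 ≤ L := zero_le_one.trans hp.one_le
  have h4 : 0 ≤ μ.real (Metric.ball (0 : E) 1) := measureReal_nonneg
  exact mul_nonneg (mul_nonneg h1 h2) (mul_nonneg (pow_nonneg h3 _) h4)

variable [Nontrivial E]

theorem exists_radialMean_exp_le_of_tendsto {g : E → ℂ} (hgc : Continuous g)
    (hg : ∀ x, ‖g x‖ ≤ C) (hp : IsRadialProfile p L M) {c : ℂ}
    (hlim : Tendsto (radialMean μ g p) atTop (𝓝 c)) :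
    ∃ K, ∀ u, ‖radialMean μ g p (Real.exp u)‖ ≤ K * min 1 (Real.exp u) := by
  obtain ⟨K, hK, hKp⟩ := exists_radialMean_exp_le (μ := μ) hgc hg hp
  have h1 : ∀ᶠ u in atTop, ‖radialMean μ g p (Real.exp u)‖ ≤ ‖c‖ + 1 :=
    ((hlim.comp Real.tendsto_exp_atTop).norm.eventually_le_const (by linarith))
  obtain ⟨u₀, hu₀⟩ := (h1.and (eventually_ge_atTop 0)).exists_forall_of_atTop
  exact ⟨_, norm_le_mul_min_one_exp (Module.finrank_pos (R := ℝ) (M := E)) (hu₀ u₀ le_rfl).2 hK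
    (by positivity) hKp fun u hu => (hu₀ u hu).1⟩

theorem integral_scaled_radialMean_comm {g : E → ℂ} (hgc : Continuous g) (hg : ∀ x, ‖g x‖ ≤ C)
    (hp : IsRadialProfile p L M) (hq : IsRadialProfile q L' M') {l : ℝ} (hl : 0 < l) :
    ∫ s : ℝ, q (Real.exp (l * (s - 1))) • radialMean μ g p (Real.exp (l * s)) =
      ∫ s : ℝ, p (Real.exp (l * (s - 1))) • radialMean μ g q (Real.exp (l * s)) := by
  rw [integral_scaled (fun u => q (Real.exp u)) (fun u => radialMean μ g p (Real.exp u)) hl,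
    integral_scaled (fun u => p (Real.exp u)) (fun u => radialMean μ g q (Real.exp u)) hl,
    integral_radialMean_comm μ hgc hg hp hq l]

/-- Exchanging the profiles turns an average of `q`-means into one of the convergent `p`-means. The
`q`-means themselves need not converge. -/
theorem tendsto_log_mean {g : E → ℂ} (hgc : Continuous g) (hg : ∀ x, ‖g x‖ ≤ C)
    (hp : IsRadialProfile p L M) (hq : IsRadialProfile q L' M') {c : ℂ}
    (hlim : Tendsto (radialMean μ g p) atTop (𝓝 c)) :
    Tendsto (fun l : ℝ => ∫ s : ℝ, p (Real.exp (l * (s - 1))) • radialMean μ g q (Real.exp (l * s)))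
      atTop (𝓝 (q 0 • c)) := by
  obtain ⟨K, hK⟩ := exists_radialMean_exp_le_of_tendsto (μ := μ) hgc hg hp hlim
  refine (hq.isLogKernel.tendsto_integral_scaled (tendsto_profile_exp_atBot hq.continuous)
    (measurable_radialMean_exp hgc hp.continuous) hK (hlim.comp Real.tendsto_exp_atTop)).congr' ?_
  filter_upwards [eventually_gt_atTop 0] with l hl
  exact integral_scaled_radialMean_comm hgc hg hp hq hl

/-- If the radial means of a family `g t` with one profile tend to a constant `c` for all `t`, while
those with a second profile, as well as their integrals over arbitrary intervals of `t`, stay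
bounded, then `c = 0`. -/
theorem radial_limit_eq_zero {g : ℝ → E → ℂ} (hgc : Continuous (Function.uncurry g))
    (hg : ∀ t x, ‖g t x‖ ≤ C) (hp : IsRadialProfile p L M) (hp0 : p 0 = 1)
    (hpn : ∀ s, 0 ≤ p s) (hq : IsRadialProfile q L' M') (hq0 : 0 < q 0) {c : ℂ}
    (hlim : ∀ t, Tendsto (radialMean μ (g t) p) atTop (𝓝 c)) {K K' R₀ : ℝ}
    (hK : ∀ R, R₀ ≤ R → ∀ t, ‖radialMean μ (g t) q R‖ ≤ K)
    (hK' : ∀ R, R₀ ≤ R → ∀ T : ℝ, ‖∫ t in (0 : ℝ)..T, radialMean μ (g t) q R‖ ≤ K') : c = 0 := by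
  have hgt : ∀ t, Continuous (g t) := fun t => hgc.comp (continuous_const.prodMk continuous_id)
  have hKn : 0 ≤ K := (norm_nonneg _).trans (hK R₀ le_rfl 0)
  have hK'n : 0 ≤ K' := (norm_nonneg _).trans (hK' R₀ le_rfl 0)
  obtain ⟨u₀, hu₀, hu₀R⟩ : ∃ u₀ : ℝ, 0 ≤ u₀ ∧ ∀ u, u₀ ≤ u → R₀ ≤ Real.exp u := by
    refine ⟨max 0 R₀, le_max_left _ _, fun u hu => ?_⟩
    linarith [Real.add_one_le_exp u, le_max_right 0 R₀]
  obtain ⟨K₁, hK₁⟩ : ∃ K₁, ∀ t u,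
      ‖radialMean μ (g t) q (Real.exp u)‖ ≤ K₁ * min 1 (Real.exp u) := by
    have h1 : 0 ≤ C := (norm_nonneg _).trans (hg 0 0)
    have h2 : 0 ≤ L' := zero_le_one.trans hq.one_le
    have h3 : 0 ≤ μ.real (Metric.ball (0 : E) 1) := measureReal_nonneg
    exact ⟨_, fun t => norm_le_mul_min_one_exp (Module.finrank_pos (R := ℝ) (M := E)) hu₀
      (mul_nonneg (mul_nonneg hq.nonneg h1) (mul_nonneg (pow_nonneg h2 _) h3)) hKn
      (fun u => norm_radialMean_le μ (hgt t) (hg t) hq (Real.exp_pos u))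
      fun u hu => hK _ (hu₀R u hu) t⟩
  have hK₁n : 0 ≤ K₁ := by simpa using (norm_nonneg _).trans (hK₁ 0 0)
  have hker := hp.isLogKernel
  have hmeas : ∀ l : ℝ, StronglyMeasurable fun z : ℝ × ℝ =>
      p (Real.exp (l * (z.2 - 1))) • radialMean μ (g z.1) q (Real.exp (l * z.2)) := fun l => by
    have h1 := (stronglyMeasurable_radialMean (μ := μ) hgc hq.continuous).comp_measurable
      (g := fun z : ℝ × ℝ => (z.1, l * z.2)) (by fun_prop)
    have h2 : Continuous fun z : ℝ × ℝ => p (Real.exp (l * (z.2 - 1))) :=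
      hp.continuous.comp (by fun_prop)
    exact h2.stronglyMeasurable.smul h1
  -- The logarithmic average of the `q`-means tends to `q 0 • c` at each time, so its integral over
  -- `[0, T]` has norm tending to `T q(0) ‖c‖`; done in the other order, the time integral comes
  -- first and is bounded by `K'`.
  have bound : ∀ T : ℝ, 0 < T → T * (q 0 * ‖c‖) ≤ K' := by
    intro T hT
    have lim1 : Tendsto (fun l : ℝ => ∫ t in (0 : ℝ)..T,
        ∫ s : ℝ, p (Real.exp (l * (s - 1))) • radialMean μ (g t) q (Real.exp (l * s))) atTop
        (𝓝 (∫ _t in (0 : ℝ)..T, q 0 • c)) := by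
      refine intervalIntegral.tendsto_integral_filter_of_dominated_convergence
        (fun _ => M * K₁ * Real.exp (1 + Real.log L)) ?_ ?_ intervalIntegrable_const ?_
      · exact Eventually.of_forall fun l => (StronglyMeasurable.integral_prod_right
          (f := fun t s => p (Real.exp (l * (s - 1))) • radialMean μ (g t) q (Real.exp (l * s)))
          (hmeas l)).aestronglyMeasurable
      · filter_upwards [eventually_ge_atTop 1] with l hl
        exact Eventually.of_forall fun t _ => hker.norm_integral_scaled_le (hK₁ t) hl
      · exact Eventually.of_forall fun t _ =>
          tendsto_log_mean (hgt t) (hg t) hp hq (hlim t)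
    -- A majorant of the time-integrated means: below `u₀` the bound `K'` is not available and a
    -- crude one growing with `T` is used. Only the value at infinity survives in the logarithmic
    -- average, so the limit is `K'`, independent of `T`.
    let N : ℝ → ℝ := fun u => if u < u₀ then T * K₁ * min 1 (Real.exp u) else K'
    have hN : ∀ u, ‖∫ t in (0 : ℝ)..T, radialMean μ (g t) q (Real.exp u)‖ ≤ N u := by
      intro u
      by_cases hu : u < u₀
      · simp only [N, if_pos hu]
        refine (intervalIntegral.norm_integral_le_of_norm_le_const
          (C := K₁ * min 1 (Real.exp u)) fun t _ => hK₁ t u).trans_eq ?_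
        rw [sub_zero, abs_of_pos hT]
        ring
      · simp only [N, if_neg hu]
        exact hK' _ (hu₀R u (not_lt.1 hu)) T
    have hNle : ∀ u, ‖(N u : ℂ)‖ ≤ (T * K₁ + K') * min 1 (Real.exp u) := by
      intro u
      have hm : 0 ≤ min 1 (Real.exp u) := le_min zero_le_one (Real.exp_pos u).le
      by_cases hu : u < u₀
      · simp only [N, if_pos hu]
        rw [Complex.norm_of_nonneg (by positivity)]
        nlinarith [mul_nonneg hK'n hm]
      · simp only [N, if_neg hu]
        rw [Complex.norm_of_nonneg hK'n,
          min_eq_left (Real.one_le_exp (hu₀.trans (not_lt.1 hu)))]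
        nlinarith [mul_nonneg hT.le hK₁n]
    have hNm : Measurable fun u => (N u : ℂ) := by
      refine Complex.measurable_ofReal.comp (Measurable.ite measurableSet_Iio ?_ measurable_const)
      fun_prop
    have hNlim : Tendsto (fun u => (N u : ℂ)) atTop (𝓝 (K' : ℂ)) := by
      refine tendsto_const_nhds.congr' ?_
      filter_upwards [eventually_ge_atTop u₀] with u hu
      simp only [N, if_neg hu.not_gt]
    have lim2 := hker.tendsto_integral_scaled (tendsto_profile_exp_atBot hp.continuous) hNm hNle
      hNlim
    rw [hp0, one_smul] at lim2
    have hle : ∀ᶠ l : ℝ in atTop, ‖∫ t in (0 : ℝ)..T,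
        ∫ s : ℝ, p (Real.exp (l * (s - 1))) • radialMean μ (g t) q (Real.exp (l * s))‖ ≤
        ‖∫ s : ℝ, p (Real.exp (l * (s - 1))) • (N (l * s) : ℂ)‖ := by
      filter_upwards [eventually_ge_atTop 1] with l hl
      have : IsFiniteMeasure (volume.restrict (Set.uIoc 0 T)) :=
        ⟨by rw [Measure.restrict_apply_univ, Set.uIoc_of_le hT.le]; exact measure_Ioc_lt_top⟩
      have hsw : Integrable (Function.uncurry fun (t s : ℝ) =>
          p (Real.exp (l * (s - 1))) • radialMean μ (g t) q (Real.exp (l * s)))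
          ((volume.restrict (Set.uIoc 0 T)).prod volume) := by
        have hb : Integrable (fun z : ℝ × ℝ => (1 : ℝ) *
            (Set.Iic (1 + Real.log L)).indicator (fun s => M * K₁ * Real.exp s) z.2)
            ((volume.restrict (Set.uIoc 0 T)).prod volume) :=
          Integrable.mul_prod (f := fun _ => (1 : ℝ)) (integrable_const _)
            (integrable_indicator_exp (1 + Real.log L) (M * K₁))
        refine hb.mono' (hmeas l).aestronglyMeasurable (Eventually.of_forall fun z => ?_)
        rw [one_mul]
        exact hker.norm_scaled_le (hK₁ z.1) hl z.2
      rw [intervalIntegral_integral_swap hsw]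
      have hint : Integrable fun s : ℝ => p (Real.exp (l * (s - 1))) • (N (l * s) : ℂ) := by
        refine (integrable_indicator_exp (1 + Real.log L) (M * (T * K₁ + K'))).mono' ?_
          (Eventually.of_forall (hker.norm_scaled_le hNle hl))
        have hGm := hker.measurable
        have h1 : Measurable fun s : ℝ => p (Real.exp (l * (s - 1))) :=
          hGm.comp (g := fun u => p (Real.exp u)) (f := fun s : ℝ => l * (s - 1)) (by fun_prop)
        have h2 : Measurable fun s : ℝ => (N (l * s) : ℂ) :=
          hNm.comp (f := fun s : ℝ => l * s) (by fun_prop)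
        exact (h1.smul h2).aestronglyMeasurable
      have hnorm : ∀ s, ‖p (Real.exp (l * (s - 1))) • (N (l * s) : ℂ)‖ =
          p (Real.exp (l * (s - 1))) * N (l * s) := fun s => by
        rw [norm_smul, Real.norm_of_nonneg (hpn _),
          Complex.norm_of_nonneg ((norm_nonneg _).trans (hN _))]
      refine (norm_integral_le_of_norm_le hint.norm (Eventually.of_forall fun s => ?_)).trans ?_
      · rw [intervalIntegral.integral_smul, norm_smul, norm_smul, Real.norm_of_nonneg (hpn _),
          Complex.norm_of_nonneg ((norm_nonneg _).trans (hN _))]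
        exact mul_le_mul_of_nonneg_left (hN _) (hpn _)
      · simp only [hnorm]
        have e : ∫ s : ℝ, p (Real.exp (l * (s - 1))) • (N (l * s) : ℂ) =
            ((∫ s : ℝ, p (Real.exp (l * (s - 1))) * N (l * s) : ℝ) : ℂ) := by
          rw [← integral_complex_ofReal]
          refine integral_congr_ae (Eventually.of_forall fun s => ?_)
          simp
        rw [e, Complex.norm_real]
        exact le_abs_self _
    have h := le_of_tendsto_of_tendsto lim1.norm lim2.norm hle
    rw [intervalIntegral.integral_const, sub_zero, norm_smul, norm_smul,
      Real.norm_of_nonneg hT.le, Real.norm_of_nonneg hq0.le, Complex.norm_of_nonneg hK'n] at h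
    exact h
  by_contra hc
  have hpos : 0 < q 0 * ‖c‖ := mul_pos hq0 (norm_pos_iff.2 hc)
  have h := bound ((K' + 1) / (q 0 * ‖c‖)) (by positivity)
  rw [div_mul_cancel₀ _ hpos.ne'] at h
  linarith

theorem tendsto_mul_exp_neg_mul {δ : ℝ} (hδ : 0 < δ) :
    Tendsto (fun l : ℝ => l * Real.exp (-δ * l)) atTop (𝓝 0) := by
  simpa using tendsto_rpow_mul_exp_neg_mul_atTop_nhds_zero 1 δ hδ

/-- If the radial means with a profile `p ≥ 0` converge, then those with a second profile have no
power law growth. -/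
theorem radial_growth_eq_zero {g : E → ℂ} (hgc : Continuous g) (hg : ∀ x, ‖g x‖ ≤ C)
    (hp : IsRadialProfile p L M) (hp1 : ∀ s, 0 ≤ s → s ≤ 1 → p s = 1) (hpn : ∀ s, 0 ≤ p s)
    (hq : IsRadialProfile q L' M') {c d : ℂ} (hlim : Tendsto (radialMean μ g p) atTop (𝓝 c))
    {δ : ℝ} (hδ : 0 < δ)
    (hd : Tendsto (fun R : ℝ => R ^ (-δ) • radialMean μ g q R) atTop (𝓝 d)) : d = 0 := by
  set ψ : ℝ → ℂ := fun u => radialMean μ g q (Real.exp u) with hψ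
  have hψlim : Tendsto (fun u => Real.exp (-δ * u) • ψ u) atTop (𝓝 d) := by
    refine (hd.comp Real.tendsto_exp_atTop).congr fun u => ?_
    simp only [Function.comp_apply, hψ]
    rw [← Real.exp_mul, mul_comm u]
  -- Damping only for `u ≥ 0` keeps the factor at most `1`, so the volume bound near radius `0` is
  -- preserved.
  obtain ⟨K, hK⟩ : ∃ K, ∀ u,
      ‖Real.exp (-δ * max u 0) • ψ u‖ ≤ K * min 1 (Real.exp u) := by
    obtain ⟨K₀, hK₀, hK₀q⟩ := exists_radialMean_exp_le (μ := μ) hgc hg hq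
    have h1 : ∀ᶠ u in atTop, ‖Real.exp (-δ * u) • ψ u‖ ≤ ‖d‖ + 1 :=
      hψlim.norm.eventually_le_const (by linarith)
    obtain ⟨u₀, hu₀⟩ := (h1.and (eventually_ge_atTop 0)).exists_forall_of_atTop
    refine ⟨_, norm_le_mul_min_one_exp (K := ‖d‖ + 1) (Module.finrank_pos (R := ℝ) (M := E)) (hu₀ u₀ le_rfl).2
      hK₀ (by positivity) (fun u => ?_) fun u hu => ?_⟩
    · rw [norm_smul, Real.norm_of_nonneg (Real.exp_pos _).le]
      have h2 : Real.exp (-δ * max u 0) ≤ 1 :=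
        Real.exp_le_one_iff.2 (by nlinarith [le_max_right u 0])
      exact (mul_le_of_le_one_left (norm_nonneg _) h2).trans (hK₀q u)
    · rw [max_eq_left (hu₀ u hu).2]
      exact (hu₀ u hu).1
  have hKn : 0 ≤ K := by simpa using (norm_nonneg _).trans (hK 0)
  set U := Real.log L with hU
  have hUn : 0 ≤ U := Real.log_nonneg hp.one_le
  -- In the integral over `u`, the damped mean decays at rate `δ` where `l + u ≥ 0` and at rate `1`
  -- where `l + u ≤ 0`; `η` is a common rate, giving a majorant independent of `l`.
  set η := min δ 1 with hη
  have hηpos : 0 < η := lt_min hδ one_pos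
  have hηδ : η ≤ δ := min_le_left _ _
  have hη1 : η ≤ 1 := min_le_right _ _
  have hbound : ∀ l, 0 ≤ l → ∀ u, u ≤ U →
      Real.exp (-δ * l) * ‖ψ (l + u)‖ ≤ K * (Real.exp ((δ - η) * U) * Real.exp (η * u)) := by
    intro l hl u hu
    have h1 := hK (l + u)
    rw [norm_smul, Real.norm_of_nonneg (Real.exp_pos _).le, neg_mul, Real.exp_neg,
      inv_mul_le_iff₀ (Real.exp_pos _)] at h1
    refine (mul_le_mul_of_nonneg_left h1 (Real.exp_pos _).le).trans ?_
    rw [← Real.exp_add]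
    have h2 : Real.exp (-δ * l) * (Real.exp (δ * max (l + u) 0) * min 1 (Real.exp (l + u))) ≤
        Real.exp ((δ - η) * U + η * u) := by
      rcases le_total 0 (l + u) with hw | hw
      · rw [max_eq_left hw, min_eq_left (Real.one_le_exp hw), mul_one, ← Real.exp_add]
        refine Real.exp_le_exp.2 ?_
        nlinarith [mul_le_mul_of_nonneg_left hu (sub_nonneg.2 hηδ)]
      · rw [max_eq_right hw, min_eq_right (Real.exp_le_one_iff.2 hw), mul_zero, Real.exp_zero,
          one_mul, ← Real.exp_add]
        refine Real.exp_le_exp.2 ?_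
        nlinarith [mul_nonneg (sub_nonneg.2 hηδ) hUn, mul_nonneg (sub_nonneg.2 hηδ) hl,
          mul_nonneg (sub_nonneg.2 hη1) (neg_nonneg.2 hw)]
    calc _ = K * (Real.exp (-δ * l) *
          (Real.exp (δ * max (l + u) 0) * min 1 (Real.exp (l + u)))) := by ring
      _ ≤ _ := mul_le_mul_of_nonneg_left h2 hKn
  have hpm : Measurable fun u : ℝ => p (Real.exp u) := hp.isLogKernel.measurable
  have hψm : Measurable ψ := measurable_radialMean_exp hgc hq.continuous
  -- If the `q`-means behave like `d R^δ`, then `exp (-δ l) ψ (l + u)` tends to `exp (δ u) d`.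
  have lim1 : Tendsto (fun l : ℝ => ∫ u : ℝ, p (Real.exp u) • (Real.exp (-δ * l) • ψ (l + u)))
      atTop (𝓝 (∫ u : ℝ, p (Real.exp u) • (Real.exp (δ * u) • d))) := by
    refine tendsto_integral_filter_of_dominated_convergence
      ((Set.Iic U).indicator fun u => M * K * Real.exp ((δ - η) * U) * Real.exp (η * u)) ?_ ?_ ?_ ?_
    · refine Eventually.of_forall fun l => ?_
      have h1 : Measurable fun u : ℝ => ψ (l + u) := hψm.comp (measurable_const_add l)
      have h2 : Measurable fun u : ℝ => Real.exp (-δ * l) • ψ (l + u) :=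
        h1.const_smul (Real.exp (-δ * l))
      exact (hpm.smul h2).aestronglyMeasurable
    · filter_upwards [eventually_ge_atTop 0] with l hl
      refine Eventually.of_forall fun u => ?_
      rw [norm_smul, norm_smul, Real.norm_of_nonneg (Real.exp_pos _).le]
      have h1 := hp.abs_exp_le u
      by_cases hu : u ∈ Set.Iic U
      · rw [Set.indicator_of_mem hu] at h1 ⊢
        refine (mul_le_mul h1 (hbound l hl u hu) (by positivity) hp.nonneg).trans_eq ?_
        ring
      · rw [Set.indicator_of_notMem hu] at h1 ⊢
        rw [Real.norm_eq_abs, le_antisymm h1 (abs_nonneg _), zero_mul]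
    · exact (integrable_indicator_iff measurableSet_Iic).2
        ((integrableOn_exp_mul_Iic hηpos _).const_mul _)
    · refine Eventually.of_forall fun u => Tendsto.const_smul ?_ _
      have h1 : Tendsto (fun l : ℝ => l + u) atTop atTop :=
        tendsto_atTop_add_const_right _ _ tendsto_id
      refine ((hψlim.comp h1).const_smul (Real.exp (δ * u))).congr fun l => ?_
      simp only [Function.comp_apply]
      rw [smul_smul, ← Real.exp_add]
      congr 2
      ring
  -- The same integral is `l exp (-δ l)` times a convergent logarithmic average.
  have lim2 : Tendsto (fun l : ℝ => ∫ u : ℝ, p (Real.exp u) • (Real.exp (-δ * l) • ψ (l + u)))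
      atTop (𝓝 0) := by
    have h1 := (tendsto_mul_exp_neg_mul hδ).smul (tendsto_log_mean hgc hg hp hq hlim)
    rw [zero_smul] at h1
    refine h1.congr' ?_
    filter_upwards [eventually_gt_atTop 0] with l hl
    rw [integral_scaled (fun u => p (Real.exp u)) ψ hl, smul_smul, mul_right_comm,
      mul_inv_cancel₀ hl.ne', one_mul, ← integral_smul]
    refine integral_congr_ae (Eventually.of_forall fun u => ?_)
    exact smul_comm _ _ _
  have h0 := tendsto_nhds_unique lim1 lim2
  simp only [smul_smul] at h0
  rw [integral_smul_const] at h0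
  -- The coefficient of `d` is the integral of `p (exp u) exp (δ u)`, positive because `p = 1` on
  -- `[0, 1]` and `p ≥ 0`.
  refine (smul_eq_zero.1 h0).resolve_left (ne_of_gt ?_)
  have hint : Integrable fun u : ℝ => p (Real.exp u) * Real.exp (δ * u) := by
    have hb : Integrable ((Set.Iic U).indicator fun u => M * Real.exp (δ * u)) :=
      (integrable_indicator_iff measurableSet_Iic).2 ((integrableOn_exp_mul_Iic hδ _).const_mul _)
    refine hb.mono' (hpm.mul (by fun_prop)).aestronglyMeasurable (Eventually.of_forall fun u => ?_)
    rw [norm_mul, Real.norm_of_nonneg (Real.exp_pos _).le]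
    have h1 := hp.abs_exp_le u
    by_cases hu : u ∈ Set.Iic U
    · rw [Set.indicator_of_mem hu] at h1 ⊢
      exact mul_le_mul_of_nonneg_right h1 (Real.exp_pos _).le
    · rw [Set.indicator_of_notMem hu] at h1 ⊢
      rw [Real.norm_eq_abs, le_antisymm h1 (abs_nonneg _), zero_mul]
  have hlow : ∫ u : ℝ, (Set.Iic (0 : ℝ)).indicator (fun u => Real.exp (δ * u)) u ≤
      ∫ u : ℝ, p (Real.exp u) * Real.exp (δ * u) := by
    refine integral_mono ((integrable_indicator_iff measurableSet_Iic).2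
      (integrableOn_exp_mul_Iic hδ _)) hint fun u => ?_
    refine Set.indicator_le' (g := fun u => p (Real.exp u) * Real.exp (δ * u))
      (fun u hu => ?_) (fun u _ => ?_) u
    · rw [hp1 _ (Real.exp_pos u).le (Real.exp_le_one_iff.2 hu), one_mul]
    · exact mul_nonneg (hpn _) (Real.exp_pos _).le
  refine lt_of_lt_of_le ?_ hlow
  rw [integral_indicator measurableSet_Iic, integral_exp_mul_Iic hδ]
  positivity

end RadialLimits


/-! ### Convolution of the cut-off with a ball. -/

section BallConvolution

variable {E : Type*} [NormedAddCommGroup E] [InnerProductSpace ℝ E] [FiniteDimensional ℝ E]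
  [MeasurableSpace E] [BorelSpace E]

/-- The convolution of `f(|x|)` with the indicator function of the unit ball. -/
def ballConv (f : ℝ → ℝ) (z : E) : ℝ := ∫ y in Metric.closedBall (0 : E) 1, f ‖z + y‖

variable {f : ℝ → ℝ} {L M : ℝ}

/-- The reflection in the hyperplane orthogonal to `z - z'` carries `z` to `z'` and preserves the
unit ball and its measure. -/
theorem ballConv_eq_of_norm_eq (f : ℝ → ℝ) {z z' : E} (h : ‖z‖ = ‖z'‖) :
    ballConv f z = ballConv f z' := by
  let ρ : E ≃ₗᵢ[ℝ] E := (ℝ ∙ (z - z'))ᗮ.reflection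
  have hρ : ρ z = z' := Submodule.reflection_sub h
  have hpre : ρ ⁻¹' Metric.closedBall (0 : E) 1 = Metric.closedBall (0 : E) 1 := by
    ext y
    simp
  have hmp := ρ.measurePreserving.setIntegral_preimage_emb
    ρ.toHomeomorph.measurableEmbedding (fun y => f ‖z' + y‖) (Metric.closedBall (0 : E) 1)
  rw [hpre] at hmp
  rw [ballConv, ballConv, ← hmp]
  refine integral_congr_ae (Eventually.of_forall fun y => ?_)
  change f ‖z + y‖ = f ‖z' + ρ y‖
  rw [← hρ, ← map_add, ρ.norm_map]

theorem continuous_ballConv (hf : Continuous f) : Continuous (ballConv f : E → ℝ) :=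
  continuous_parametric_integral_of_continuous (by fun_prop) (isCompact_closedBall (0 : E) 1)

theorem abs_ballConv_le (hf : IsRadialProfile f L M) (z : E) :
    |ballConv f z| ≤ M * volume.real (Metric.closedBall (0 : E) 1) := by
  rw [ballConv, ← Real.norm_eq_abs]
  exact norm_setIntegral_le_of_norm_le_const measure_closedBall_lt_top
    fun y _ => hf.bound _ (norm_nonneg (z + y))

theorem ballConv_eq_zero (hf : IsRadialProfile f L M) {z : E} (hz : L + 1 ≤ ‖z‖) :
    ballConv f z = 0 := by
  refine setIntegral_eq_zero_of_forall_eq_zero fun y hy => hf.eq_zero _ ?_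
  rw [mem_closedBall_zero_iff] at hy
  have h := norm_sub_norm_le z (-y)
  rw [norm_neg, sub_neg_eq_add] at h
  linarith

theorem ballConv_zero_pos (hf1 : ∀ s, 0 ≤ s → s ≤ 1 → f s = 1) : 0 < ballConv f (0 : E) := by
  have h : ballConv f (0 : E) = ∫ _y in Metric.closedBall (0 : E) 1, (1 : ℝ) := by
    refine setIntegral_congr_fun measurableSet_closedBall fun y hy => ?_
    simp only [zero_add]
    exact hf1 _ (norm_nonneg _) (mem_closedBall_zero_iff.1 hy)
  rw [h, setIntegral_const, smul_eq_mul, mul_one]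
  exact ENNReal.toReal_pos (Metric.measure_closedBall_pos _ _ one_pos).ne'
    measure_closedBall_lt_top.ne

/-- The radial profile of `ballConv f`. -/
theorem exists_radialProfile_ballConv [Nontrivial E] (hf : IsRadialProfile f L M)
    (hf1 : ∀ s, 0 ≤ s → s ≤ 1 → f s = 1) :
    ∃ (q : ℝ → ℝ) (L' M' : ℝ), IsRadialProfile q L' M' ∧ 0 < q 0 ∧
      ∀ z : E, ballConv f z = q ‖z‖ := by
  obtain ⟨e, he⟩ := exists_norm_eq E zero_le_one
  refine ⟨fun s => ballConv f (s • e), L + 1, M * volume.real (Metric.closedBall (0 : E) 1),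
    ⟨(continuous_ballConv hf.continuous).comp (by fun_prop), by linarith [hf.one_le],
      fun s _ => abs_ballConv_le hf _, fun s hs => ballConv_eq_zero hf ?_⟩, ?_, fun z => ?_⟩
  · rw [norm_smul, he, mul_one]
    exact hs.trans (le_abs_self s)
  · simpa using ballConv_zero_pos (E := E) hf1
  · refine ballConv_eq_of_norm_eq f ?_
    rw [norm_smul, he, mul_one, norm_norm]

theorem setIntegral_closedBall_profile (f : ℝ → ℝ) {R : ℝ} (hR : 0 < R) (z : E) :
    ∫ y in Metric.closedBall (0 : E) R, f (‖z + y‖ / R) =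
      R ^ Module.finrank ℝ E * ballConv f (R⁻¹ • z) := by
  have h := Measure.setIntegral_comp_smul_of_pos (volume : Measure E)
    (fun y => f (‖z + y‖ / R)) (Metric.closedBall (0 : E) 1) hR
  rw [smul_closedBall _ _ zero_le_one, smul_zero, mul_one, Real.norm_of_nonneg hR.le] at h
  rw [ballConv]
  have e : ∀ y : E, f ‖R⁻¹ • z + y‖ = f (‖z + R • y‖ / R) := fun y => by
    congr 1
    rw [show z + R • y = R • (R⁻¹ • z + y) by rw [smul_add, smul_inv_smul₀ hR.ne'], norm_smul,
      Real.norm_of_nonneg hR.le, mul_div_cancel_left₀ _ hR.ne']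
  simp only [e]
  rw [h, smul_eq_mul, mul_inv_cancel_left₀ (pow_pos hR _).ne']

/-- After the shift `x = z + y` and Fubini, the integral over the ball acts on the cut-off alone;
rescaling by `R` produces the volume factor. This makes the commutator of two extensive quantities a
single radial mean. -/
theorem integral_closedBall_translate {g : E → ℂ} {C : ℝ} (hgc : Continuous g)
    (hg : ∀ x, ‖g x‖ ≤ C) (hf : IsRadialProfile f L M) {R : ℝ} (hR : 0 < R) :
    ∫ y in Metric.closedBall (0 : E) R, ∫ x, f (‖x‖ / R) • g (x - y) =
      R ^ Module.finrank ℝ E • ∫ z, ballConv f (R⁻¹ • z) • g z := by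
  have hfc := hf.continuous
  have h1 : ∀ y : E, ∫ x, f (‖x‖ / R) • g (x - y) = ∫ z, f (‖z + y‖ / R) • g z := fun y => by
    rw [← integral_add_right_eq_self _ y]
    simp
  simp only [h1]
  have hfin : IsFiniteMeasure (volume.restrict (Metric.closedBall (0 : E) R)) :=
    ⟨by rw [Measure.restrict_apply_univ]; exact measure_closedBall_lt_top⟩
  have hint : Integrable (Function.uncurry fun y z : E => f (‖z + y‖ / R) • g z)
      ((volume.restrict (Metric.closedBall (0 : E) R)).prod volume) := by
    have hb : Integrable (fun w : E × E => (1 : ℝ) *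
        (Metric.closedBall (0 : E) ((L + 1) * R)).indicator (fun _ => M * C) w.2)
        ((volume.restrict (Metric.closedBall (0 : E) R)).prod volume) :=
      Integrable.mul_prod (f := fun _ => (1 : ℝ)) (integrable_const _)
        (integrable_indicator_closedBall volume _ _)
    refine hb.mono' (Continuous.aestronglyMeasurable (by fun_prop)) ?_
    have hae : ∀ᵐ w ∂((volume.restrict (Metric.closedBall (0 : E) R)).prod (volume : Measure E)),
        w.1 ∈ Metric.closedBall (0 : E) R :=
      Measure.quasiMeasurePreserving_fst.ae (ae_restrict_mem measurableSet_closedBall)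
    filter_upwards [hae] with w hw
    rw [one_mul]
    change ‖f (‖w.2 + w.1‖ / R) • g w.2‖ ≤ _
    by_cases hz : w.2 ∈ Metric.closedBall (0 : E) ((L + 1) * R)
    · rw [Set.indicator_of_mem hz, norm_smul]
      exact mul_le_mul (hf.bound _ (by positivity)) (hg _) (norm_nonneg _) hf.nonneg
    · rw [Set.indicator_of_notMem hz, hf.eq_zero, zero_smul, norm_zero]
      rw [mem_closedBall_zero_iff] at hw
      rw [mem_closedBall_zero_iff, not_le] at hz
      rw [le_div_iff₀ hR]
      have h := norm_sub_norm_le w.2 (-w.1)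
      rw [norm_neg, sub_neg_eq_add] at h
      linarith
  rw [integral_integral_swap hint, ← integral_smul]
  refine integral_congr_ae (Eventually.of_forall fun z => ?_)
  change ∫ y in Metric.closedBall (0 : E) R, f (‖z + y‖ / R) • g z =
    R ^ Module.finrank ℝ E • ballConv f (R⁻¹ • z) • g z
  rw [integral_smul_const, setIntegral_closedBall_profile f hR, mul_smul]

end BallConvolution

/-! ### Commutators of `Q_R` with `A(t)` and `A_R(t)` as radial means. -/

namespace QuasiLocalSystem

theorem IsCutoff.exists_isRadialProfile {f : ℝ → ℝ} (hf : IsCutoff f) :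
    ∃ M, IsRadialProfile f 2 M := by
  have hc : Continuous f := hf.smooth.continuous
  obtain ⟨M, hM⟩ := (isCompact_Icc (a := (0 : ℝ)) (b := 2)).exists_bound_of_continuousOn
    hc.continuousOn
  have hM0 : 0 ≤ M := (norm_nonneg _).trans (hM 0 (by norm_num))
  refine ⟨M, hc, one_le_two, fun s hs => ?_, hf.eq_zero⟩
  rcases le_total s 2 with h | h
  · exact hM s ⟨hs, h⟩
  · rw [hf.eq_zero s h, abs_zero]
    exact hM0

variable {n : ℕ} {H : Type*} [NormedAddCommGroup H] [InnerProductSpace ℂ H]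

theorem commForm_smul_left (r : ℝ) (v w : H) : commForm (r • v) w = r • commForm v w := by
  rw [commForm, commForm, ← Complex.coe_smul r v, inner_smul_left, inner_smul_right,
    Complex.conj_ofReal, Complex.real_smul]
  ring

theorem commForm_smul_right (r : ℝ) (v w : H) : commForm v (r • w) = r • commForm v w := by
  rw [commForm_swap, commForm_smul_left, ← smul_neg, ← commForm_swap]

variable [CompleteSpace H]

theorem commForm_integral_right {α : Type*} [MeasurableSpace α] {μ : Measure α} (v : H)
    {F : α → H} (hF : Integrable F μ) :
    commForm v (∫ a, F a ∂μ) = ∫ a, commForm v (F a) ∂μ := by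
  have h : ⟪∫ a, F a ∂μ, v⟫_ℂ = ∫ a, ⟪F a, v⟫_ℂ ∂μ := by
    rw [← inner_conj_symm, ← integral_inner hF, ← integral_conj]
    simp only [inner_conj_symm]
  simp only [commForm]
  rw [integral_sub (hF.const_inner v) (hF.inner_const v), integral_inner hF, h]

theorem commForm_integral_left {α : Type*} [MeasurableSpace α] {μ : Measure α} (v : H)
    {F : α → H} (hF : Integrable F μ) :
    commForm (∫ a, F a ∂μ) v = ∫ a, commForm (F a) v ∂μ := by
  rw [commForm_swap, commForm_integral_right v hF, ← integral_neg]
  simp only [← commForm_swap]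

variable (S : QuasiLocalSystem n H)

/-- The vector `X Ω` of an observable. -/
def obsVec (X : S.Observable) : H := X.op ⟨S.Ω, X.vacuum_mem⟩

theorem obsVec_mem_realSpace (X : S.Observable) : S.obsVec X ∈ S.realSpace :=
  S.observable_mem_realSpace X

theorem vec_conjOp (X : S.Observable) {u : H ≃ₗᵢ[ℂ] H} (hu : u S.Ω = S.Ω) :
    S.vec (conjOp u X.op) = u (S.obsVec X) := by
  have hfix : u.symm S.Ω = S.Ω := by rw [LinearIsometryEquiv.symm_apply_eq, hu]
  have hmem : S.Ω ∈ (conjOp u X.op).domain := by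
    change u.symm S.Ω ∈ X.op.domain
    rw [hfix]
    exact X.vacuum_mem
  rw [vec, dif_pos hmem]
  change u (X.op ⟨u.symm S.Ω, _⟩) = u (X.op _)
  congr 2
  exact Subtype.ext hfix

theorem vec_evolve (X : S.Observable) (t : ℝ) :
    S.vec (S.evolve X.op t) = S.time.toFun t (S.obsVec X) :=
  S.vec_conjOp X (S.time_Ω t)

theorem vec_translate (X : S.Observable) (x : EuclideanSpace ℝ (Fin n)) :
    S.vec (S.translate X.op x) = S.space.toFun x (S.obsVec X) :=
  S.vec_conjOp X (S.space_Ω x)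

theorem vec_observable (X : S.Observable) : S.vec X.op = S.obsVec X := by
  rw [vec, dif_pos X.vacuum_mem, obsVec]

theorem vec_smul (r : ℝ) (X : H →ₗ.[ℂ] H) : S.vec (r • X) = r • S.vec X := by
  by_cases h : S.Ω ∈ X.domain
  · have h' : S.Ω ∈ (r • X).domain := h
    rw [vec, vec, dif_pos h, dif_pos h']
    rfl
  · have h' : S.Ω ∉ (r • X).domain := h
    rw [vec, vec, dif_neg h, dif_neg h', smul_zero]

theorem commutator_eq (X Y : H →ₗ.[ℂ] H) : S.commutator X Y = commForm (S.vec X) (S.vec Y) := rfl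

theorem autocorrelation_eq (X : H →ₗ.[ℂ] H) : S.autocorrelation X = ‖S.truncate (S.vec X)‖ ^ 2 :=
  (S.norm_truncate_sq _).symm

theorem autocorrelation_smul (r : ℝ) (X : H →ₗ.[ℂ] H) :
    S.autocorrelation (r • X) = r ^ 2 * ‖S.truncate (S.vec X)‖ ^ 2 := by
  have h : S.truncate (r • S.vec X) = r • S.truncate (S.vec X) := by
    rw [truncate, truncate, ← Complex.coe_smul, inner_smul_right, ← Complex.coe_smul, smul_sub,
      smul_smul]
  rw [autocorrelation_eq, vec_smul, h, norm_smul, mul_pow, Real.norm_eq_abs, sq_abs]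

theorem FiniteAutocorrelation.exists_norm_truncate_le {X : ℝ → (H →ₗ.[ℂ] H)} {γ : ℝ}
    (h : S.FiniteAutocorrelation X γ) :
    ∃ C : ℝ, 0 ≤ C ∧ ∀ᶠ R : ℝ in atTop, ‖S.truncate (S.vec (X R))‖ ≤ C * R ^ γ := by
  obtain ⟨C, hC⟩ := h
  refine ⟨√C, Real.sqrt_nonneg _, ?_⟩
  filter_upwards [hC, eventually_gt_atTop 0] with R hR hR0
  rw [autocorrelation_smul, ← mul_pow] at hR
  have h1 := Real.le_sqrt_of_sq_le hR
  rw [Real.rpow_neg hR0.le, inv_mul_le_iff₀ (Real.rpow_pos_of_pos hR0 _)] at h1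
  rwa [mul_comm]

theorem integrable_smul_space {w : EuclideanSpace ℝ (Fin n) → ℝ} (hw : Integrable w) (v : H) :
    Integrable fun x => w x • S.space.toFun x v :=
  hw.smul_bdd ‖v‖ (S.space.continuous_apply v).aestronglyMeasurable
    (Eventually.of_forall fun x => by rw [LinearIsometryEquiv.norm_map])

theorem vec_smear_mem_realSpace (X : S.Observable) {w : EuclideanSpace ℝ (Fin n) → ℝ}
    (hw : Integrable w) : S.vec (S.smear X.op w) ∈ S.realSpace := by
  rw [(S.smear_vacuum X w hw).2]
  exact S.integral_mem_realSpace fun x =>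
    Submodule.smul_mem _ _ (S.space_mem_realSpace x (S.obsVec_mem_realSpace X))

variable {f : ℝ → ℝ} {L M : ℝ}

theorem integrable_profile (hf : IsRadialProfile f L M) {R : ℝ} (hR : 0 < R) :
    Integrable fun x : EuclideanSpace ℝ (Fin n) => f (‖x‖ / R) := by
  have h := integrable_radial_smul (volume : Measure (EuclideanSpace ℝ (Fin n)))
    (g := fun _ => (1 : ℂ)) (C := 1) continuous_const (by simp) hf hR
  refine h.re.congr (Eventually.of_forall fun x => ?_)
  simp

theorem vec_chargeR_mem (hf : IsRadialProfile f L M) (q : S.Observable) {R : ℝ} (hR : 0 < R) :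
    S.vec (S.chargeR f q R) ∈ S.realSpace :=
  S.vec_smear_mem_realSpace q (integrable_profile hf hR)

theorem vec_ballR_mem (A : S.Observable) (R : ℝ) : S.vec (S.ballR A R) ∈ S.realSpace :=
  S.vec_smear_mem_realSpace A (integrable_indicator_closedBall volume R 1)

/-- The commutator function `(Ω, [q(x), A(t)] Ω)`. -/
def commFun (q A : S.Observable) (t : ℝ) (x : EuclideanSpace ℝ (Fin n)) : ℂ :=
  commForm (S.space.toFun x (S.obsVec q)) (S.time.toFun t (S.obsVec A))

theorem continuous_commFun (q A : S.Observable) :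
    Continuous (Function.uncurry (S.commFun q A)) := by
  have h1 : Continuous fun p : ℝ × EuclideanSpace ℝ (Fin n) => S.space.toFun p.2 (S.obsVec q) :=
    (S.space.continuous_apply _).comp continuous_snd
  have h2 : Continuous fun p : ℝ × EuclideanSpace ℝ (Fin n) => S.time.toFun p.1 (S.obsVec A) :=
    (S.time.continuous_apply _).comp continuous_fst
  exact continuous_commForm.comp (h1.prodMk h2)

theorem continuous_commFun_right (q A : S.Observable) (t : ℝ) : Continuous (S.commFun q A t) :=
  (S.continuous_commFun q A).comp (continuous_const.prodMk continuous_id)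

theorem norm_commFun_le (q A : S.Observable) (t : ℝ) (x : EuclideanSpace ℝ (Fin n)) :
    ‖S.commFun q A t x‖ ≤ 2 * (‖S.obsVec q‖ * ‖S.obsVec A‖) := by
  refine (norm_commForm_le _ _).trans_eq ?_
  rw [LinearIsometryEquiv.norm_map, LinearIsometryEquiv.norm_map]

/-- Space and time commute, so the unitary `U(y)` can be removed from both arguments. -/
theorem commForm_space_time (q A : S.Observable) (t : ℝ) (x y : EuclideanSpace ℝ (Fin n)) :
    commForm (S.space.toFun x (S.obsVec q))
      (S.time.toFun t (S.space.toFun y (S.obsVec A))) = S.commFun q A t (x - y) := by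
  have h : S.space.toFun x (S.obsVec q) =
      S.space.toFun y (S.space.toFun (x - y) (S.obsVec q)) := by
    rw [← S.space.map_add, add_sub_cancel]
  rw [← S.space_time, h]
  simp only [commForm, commFun, LinearIsometryEquiv.inner_map_map]

theorem commutator_chargeR_evolve (hf : IsRadialProfile f L M) (q A : S.Observable) {R : ℝ}
    (hR : 0 < R) (t : ℝ) : S.commutator (S.chargeR f q R) (S.evolve A.op t) =
      radialMean volume (S.commFun q A t) f R := by
  rw [commutator_eq, vec_evolve, chargeR, (S.smear_vacuum q _ (integrable_profile hf hR)).2,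
    commForm_integral_left _ (S.integrable_smul_space (integrable_profile hf hR) _)]
  simp only [commForm_smul_left]
  rfl

theorem commForm_chargeR_ballR (hf : IsRadialProfile f L M) (q A : S.Observable) {h : ℝ → ℝ}
    (hh : ∀ z : EuclideanSpace ℝ (Fin n), ballConv f z = h ‖z‖) {R : ℝ}
    (hR : 0 < R) (t : ℝ) :
    commForm (S.vec (S.chargeR f q R)) (S.time.toFun t (S.vec (S.ballR A R))) =
      R ^ n • radialMean volume (S.commFun q A t) h R := by
  have hball := integrable_indicator_closedBall
    (volume : Measure (EuclideanSpace ℝ (Fin n))) R (1 : ℝ)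
  have e1 : S.time.toFun t (S.vec (S.ballR A R)) = ∫ y in Metric.closedBall
      (0 : EuclideanSpace ℝ (Fin n)) R, S.time.toFun t (S.space.toFun y (S.obsVec A)) := by
    rw [ballR, (S.smear_vacuum A _ hball).2, ← integral_indicator measurableSet_closedBall]
    refine ((S.time.toFun t : H →L[ℂ] H).integral_comp_comm
      (S.integrable_smul_space hball _)).symm.trans ?_
    refine integral_congr_ae (Eventually.of_forall fun y => ?_)
    change S.time.toFun t (_ • S.space.toFun y (S.obsVec A)) = _
    by_cases hy : y ∈ Metric.closedBall (0 : EuclideanSpace ℝ (Fin n)) R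
    · rw [Set.indicator_of_mem hy, Set.indicator_of_mem hy, one_smul]
    · rw [Set.indicator_of_notMem hy, Set.indicator_of_notMem hy, zero_smul, map_zero]
  have hint : IntegrableOn (fun y => S.time.toFun t (S.space.toFun y (S.obsVec A)))
      (Metric.closedBall (0 : EuclideanSpace ℝ (Fin n)) R) :=
    ((S.time.toFun t).continuous.comp (S.space.continuous_apply _)).continuousOn.integrableOn_compact
      (isCompact_closedBall _ _)
  rw [e1, commForm_integral_right _ hint]
  have e2 : ∀ y, commForm (S.vec (S.chargeR f q R))
      (S.time.toFun t (S.space.toFun y (S.obsVec A))) =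
      ∫ x, f (‖x‖ / R) • S.commFun q A t (x - y) := fun y => by
    rw [chargeR, (S.smear_vacuum q _ (integrable_profile hf hR)).2,
      commForm_integral_left _ (S.integrable_smul_space (integrable_profile hf hR) _)]
    refine integral_congr_ae (Eventually.of_forall fun x => ?_)
    simp only [commForm_smul_left]
    exact congrArg _ (S.commForm_space_time q A t x y)
  simp only [e2]
  rw [integral_closedBall_translate (S.continuous_commFun_right q A t) (S.norm_commFun_le q A t)
    hf hR, finrank_euclideanSpace_fin]
  congr 1
  refine integral_congr_ae (Eventually.of_forall fun z => ?_)
  simp only [hh, norm_smul, norm_inv, Real.norm_of_nonneg hR.le, inv_mul_eq_div]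

end QuasiLocalSystem


/-! ### The inequality `a + b > n` and the conclusion. -/

namespace QuasiLocalSystem

variable {n : ℕ} {H : Type*} [NormedAddCommGroup H] [InnerProductSpace ℂ H] [CompleteSpace H]
variable (S : QuasiLocalSystem n H)

/-- In a KMS state there is no spontaneous symmetry breaking in space dimension zero. -/
theorem not_SSB_of_dim_zero {β : ℝ} (hβ : 0 < β) (hKMS : S.IsKMS β) {f : ℝ → ℝ} (hf : IsCutoff f)
    {q A : S.Observable} (hn : n = 0) : ¬ S.SSB f q A := by
  rintro ⟨c, hc, hlim⟩
  subst hn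
  obtain ⟨M, hM⟩ := hf.exists_isRadialProfile
  -- Over a point `Q_R` does not depend on `R`, so the commutator equals `c` at all times, against
  -- the bounded time integrals.
  have hconst : ∀ R : ℝ, S.chargeR f q R = S.chargeR f q 1 := fun R => by
    have h : (fun x : EuclideanSpace ℝ (Fin 0) => f (‖x‖ / R)) = fun x => f (‖x‖ / 1) := by
      funext x
      rw [Subsingleton.elim x 0, norm_zero, zero_div, zero_div]
    rw [chargeR, h, chargeR]
  have hval : ∀ t, commForm (S.vec (S.chargeR f q 1)) (S.time.toFun t (S.obsVec A)) = c := fun t => by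
    have h := hlim t
    simp only [hconst] at h
    rw [← S.vec_evolve]
    exact tendsto_nhds_unique tendsto_const_nhds h
  set K := 2 * β * (‖S.vec (S.chargeR f q 1)‖ * ‖S.obsVec A‖) with hK
  have hbound : ∀ T : ℝ, |T| * ‖c‖ ≤ K := fun T => by
    have h := S.norm_integral_commForm_le hβ hKMS (S.vec_chargeR_mem hM q one_pos)
      (S.obsVec_mem_realSpace A) T
    simp only [hval] at h
    rwa [intervalIntegral.integral_const, sub_zero, norm_smul, Real.norm_eq_abs] at h
  have hcpos : 0 < ‖c‖ := norm_pos_iff.2 hc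
  have h := (mul_le_mul_of_nonneg_right (le_abs_self _) hcpos.le).trans (hbound ((K + 1) / ‖c‖))
  rw [div_mul_cancel₀ _ hcpos.ne'] at h
  linarith

/-- If the symmetry is broken, then the exponents for which the auto-correlations of the pair stay
bounded satisfy `a + b > n`. -/
theorem lt_add_of_finiteAutocorrelation {β : ℝ} (hβ : 0 < β) (hKMS : S.IsKMS β) {f : ℝ → ℝ}
    (hf : IsCutoff f) {q A : S.Observable} (hSSB : S.SSB f q A) {a b : ℝ}
    (ha : S.FiniteAutocorrelation (S.chargeR f q) a)
    (hb : S.FiniteAutocorrelation (S.ballR A) b) : (n : ℝ) < a + b := by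
  rcases Nat.eq_zero_or_pos n with hn | hn
  · exact absurd hSSB (S.not_SSB_of_dim_zero hβ hKMS hf hn)
  have : Nonempty (Fin n) := ⟨⟨0, hn⟩⟩
  obtain ⟨c, hc, hlim⟩ := hSSB
  obtain ⟨M, hM⟩ := hf.exists_isRadialProfile
  obtain ⟨h, L', M', hh, hh0, hball⟩ :=
    exists_radialProfile_ballConv (E := EuclideanSpace ℝ (Fin n)) hM hf.eq_one
  by_contra! hab
  refine hc ?_
  obtain ⟨C₁, hC₁, h₁⟩ := FiniteAutocorrelation.exists_norm_truncate_le S ha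
  obtain ⟨C₂, hC₂, h₂⟩ := FiniteAutocorrelation.exists_norm_truncate_le S hb
  -- For `R ≥ 1` and `a + b ≤ n` the product of truncated norms is `O(R^n)`, which the factor `R^n`
  -- from the ball cancels exactly.
  have hev : ∀ᶠ R : ℝ in atTop, 0 < R ∧ ‖S.truncate (S.vec (S.chargeR f q R))‖ *
      ‖S.truncate (S.vec (S.ballR A R))‖ ≤ C₁ * C₂ * R ^ n := by
    filter_upwards [h₁, h₂, eventually_ge_atTop 1] with R hR₁ hR₂ hR
    have hR0 : 0 < R := zero_lt_one.trans_le hR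
    refine ⟨hR0, (mul_le_mul hR₁ hR₂ (norm_nonneg _) (by positivity)).trans ?_⟩
    calc C₁ * R ^ a * (C₂ * R ^ b) = C₁ * C₂ * R ^ (a + b) := by
          rw [Real.rpow_add hR0]; ring
      _ ≤ C₁ * C₂ * R ^ (n : ℝ) := by
          gcongr
      _ = _ := by rw [Real.rpow_natCast]
  obtain ⟨R₀, hR₀⟩ := hev.exists_forall_of_atTop
  have key : ∀ R, R₀ ≤ R → ∀ t, radialMean volume (S.commFun q A t) h R = (R ^ n)⁻¹ •
      commForm (S.vec (S.chargeR f q R)) (S.time.toFun t (S.vec (S.ballR A R))) := fun R hR t => by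
    have hR0 := (hR₀ R hR).1
    rw [S.commForm_chargeR_ballR hM q A hball hR0, inv_smul_smul₀ (pow_pos hR0 n).ne']
  refine radial_limit_eq_zero (μ := (volume : Measure (EuclideanSpace ℝ (Fin n))))
    (S.continuous_commFun q A) (S.norm_commFun_le q A) hM (hf.eq_one 0 le_rfl zero_le_one)
    hf.nonneg hh hh0 (c := c) (fun t => ?_) (K := 2 * (C₁ * C₂)) (K' := 2 * β * (C₁ * C₂))
    (R₀ := R₀) (fun R hR t => ?_) fun R hR T => ?_
  · refine (hlim t).congr' ?_
    filter_upwards [eventually_gt_atTop 0] with R hR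
    exact S.commutator_chargeR_evolve hM q A hR t
  · obtain ⟨hR0, hle⟩ := hR₀ R hR
    rw [key R hR, norm_smul, norm_inv, Real.norm_of_nonneg (by positivity),
      inv_mul_le_iff₀ (by positivity)]
    refine (S.norm_commForm_time_le (S.vec_chargeR_mem hM q hR0) (S.vec_ballR_mem A R) t).trans ?_
    linarith
  · obtain ⟨hR0, hle⟩ := hR₀ R hR
    simp only [key R hR]
    rw [intervalIntegral.integral_smul, norm_smul, norm_inv, Real.norm_of_nonneg (by positivity),
      inv_mul_le_iff₀ (by positivity)]
    refine (S.norm_integral_commForm_le_truncate hβ hKMS (S.vec_chargeR_mem hM q hR0)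
      (S.vec_ballR_mem A R) T).trans ?_
    nlinarith [mul_le_mul_of_nonneg_left hle (by positivity : 0 ≤ 2 * β)]

theorem commutator_scaled_eq {f : ℝ → ℝ} {L M : ℝ} (hM : IsRadialProfile f L M)
    (q A : S.Observable) {h : ℝ → ℝ}
    (hball : ∀ z : EuclideanSpace ℝ (Fin n), ballConv f z = h ‖z‖) (a b : ℝ) {R : ℝ} (hR : 0 < R) :
    S.commutator (R ^ (-a) • S.chargeR f q R) (R ^ (-b) • S.ballR A R) =
      R ^ (-(a + b - n)) • radialMean volume (S.commFun q A 0) h R := by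
  have h0 := S.commForm_chargeR_ballR hM q A hball hR 0
  rw [S.time.zero_apply] at h0
  rw [commutator_eq, vec_smul, vec_smul, commForm_smul_left, commForm_smul_right, h0, smul_smul,
    smul_smul, ← Real.rpow_natCast, ← Real.rpow_add hR, ← Real.rpow_add hR]
  congr 2
  ring

theorem norm_radialMean_le_of_integrable {E : Type*} [NormedAddCommGroup E] [MeasurableSpace E]
    [NormedSpace ℝ E] {μ : Measure E} {g : E → ℂ} (hg : Integrable g μ) {p : ℝ → ℝ} {L M : ℝ}
    (hp : IsRadialProfile p L M) {R : ℝ} (hR : 0 < R) :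
    ‖radialMean μ g p R‖ ≤ M * ∫ x, ‖g x‖ ∂μ := by
  rw [← integral_const_mul]
  refine norm_integral_le_of_norm_le (hg.norm.const_mul M) (Eventually.of_forall fun x => ?_)
  rw [norm_smul]
  exact mul_le_mul_of_nonneg_right (hp.bound _ (by positivity)) (norm_nonneg _)

end QuasiLocalSystem

end

theorem mainTheorem6 {n : ℕ} {H : Type*} [NormedAddCommGroup H] [InnerProductSpace ℂ H]
    [CompleteSpace H] (S : QuasiLocalSystem n H) (β : ℝ) (hβ : 0 < β) (hKMS : S.IsKMS β)
    (f : ℝ → ℝ) (hf : QuasiLocalSystem.IsCutoff f) (q A : S.Observable) (hSSB : S.SSB f q A) :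
    (∀ α : ℝ,
      ¬ (S.FiniteAutocorrelation (S.chargeR f q) α ∧
        S.FiniteAutocorrelation (S.ballR A) ((n : ℝ) - α))) ∧
    (∀ a b : ℝ,
      S.FiniteAutocorrelation (S.chargeR f q) a →
      S.FiniteAutocorrelation (S.ballR A) b →
      (∀ d : ℂ,
        Tendsto (fun R : ℝ => S.commutator (R ^ (-a) • S.chargeR f q R) (R ^ (-b) • S.ballR A R))
          atTop (𝓝 d) → d = 0) ∧
      (Integrable (fun x => S.commutator (S.translate q.op x) A.op) →
        Tendsto (fun R : ℝ => S.commutator (R ^ (-a) • S.chargeR f q R) (R ^ (-b) • S.ballR A R))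
          atTop (𝓝 0))) := by
  refine ⟨fun α h => ?_, fun a b ha hb => ?_⟩
  · have := S.lt_add_of_finiteAutocorrelation hβ hKMS hf hSSB h.1 h.2
    linarith
  have hab := S.lt_add_of_finiteAutocorrelation hβ hKMS hf hSSB ha hb
  rcases Nat.eq_zero_or_pos n with hn | hn
  · exact absurd hSSB (S.not_SSB_of_dim_zero hβ hKMS hf hn)
  have : Nonempty (Fin n) := ⟨⟨0, hn⟩⟩
  obtain ⟨c, hc, hlim⟩ := hSSB
  obtain ⟨M, hM⟩ := hf.exists_isRadialProfile
  obtain ⟨h, L', M', hh, hh0, hball⟩ :=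
    exists_radialProfile_ballConv (E := EuclideanSpace ℝ (Fin n)) hM hf.eq_one
  -- The excess `a + b - n` is the decay exponent left in front of the radial mean of the scaled
  -- commutator.
  have hδ : 0 < a + b - n := by linarith
  refine ⟨fun d hd => ?_, fun hint => ?_⟩
  · refine radial_growth_eq_zero (μ := (volume : Measure (EuclideanSpace ℝ (Fin n))))
      (S.continuous_commFun_right q A 0) (S.norm_commFun_le q A 0) hM hf.eq_one hf.nonneg hh
      (c := c) ((hlim 0).congr' ?_) hδ (hd.congr' ?_)
    · filter_upwards [eventually_gt_atTop 0] with R hR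
      exact S.commutator_chargeR_evolve hM q A hR 0
    · filter_upwards [eventually_gt_atTop 0] with R hR
      exact S.commutator_scaled_eq hM q A hball a b hR
  · have hg : Integrable (S.commFun q A 0) := by
      refine hint.congr (Eventually.of_forall fun x => ?_)
      change S.commutator _ _ = _
      rw [S.commutator_eq, S.vec_translate, S.vec_observable, QuasiLocalSystem.commFun,
        S.time.zero_apply]
    have hlim0 := (tendsto_rpow_neg_atTop hδ).mul_const (M' * ∫ x, ‖S.commFun q A 0 x‖)
    rw [zero_mul] at hlim0
    refine squeeze_zero_norm' ?_ hlim0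
    filter_upwards [eventually_gt_atTop 0] with R hR
    rw [S.commutator_scaled_eq hM q A hball a b hR, norm_smul,
      Real.norm_of_nonneg (Real.rpow_nonneg hR.le _)]
    exact mul_le_mul_of_nonneg_left
      (QuasiLocalSystem.norm_radialMean_le_of_integrable hg hh hR) (Real.rpow_nonneg hR.le _)
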